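/- Let $n\ge 1$, let $B_r(y)$ be the open ball of radius $r$ and centre $y$ in $\mathbb R^n$, and $B_r=B_r(0)$. Let $\delta,\gamma\colon B_1\to[0,\infty)$ be bounded measurable functions, put $\gamma_*=\operatorname{ess\,inf}_{B_1}\gamma$ and $\gamma^*(y,r)=\operatorname{ess\,sup}_{B_r(y)}\gamma$, and assume $0<\gamma_*\le\gamma^*(0,1)\le 1$. Let $u\in H^1(B_1)$, $0\le u\le 1$ a.e., be a local minimizer in $B_1$ of $$\mathcal J(v,\Omega)=\int_{\Omega}\tfrac12|Dv|^2+\delta(x)\,(v^+)^{\gamma(x)}\,dx ,$$ that is, $\mathcal J(u,\Omega')\le\mathcal J(v,\Omega')$ for every open $\Omega'\subseteq B_1$ and every $v\in H^1(\Omega')$ with $v-u\in H^1_0(\Omega')$. Pointwise values of $u$ are those of its precise representative $u(x)=\limsup_{\rho\to0^+}\frac1{|B_\rho(x)|}\int_{B_\rho(x)}u$, which coincides with the continuous representative of $u$ wherever there is one. Write $\{u>0\}=\{x\in B_1: u(x)>0\}$ and $F(u)=\partial\{u>0\}$. Assume $\delta\ge\delta_0$ a.e. in $B_1$ for a constant $\delta_0>0$,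 and $\gamma_*\ge\gamma_0$ for a constant $\gamma_0>0$ (for instance $\gamma_0=\gamma_*$). (1) There is a constant $c>0$, depending only on $n,\delta_0,\gamma_0$, such that $$\sup_{\partial B_r(y)}u\ \ge\ c\,r^{\frac{2}{2-\gamma^*(y,r)}}\qquad\text{for all } y\in\overline{\{u>0\}}\cap B_{1/2}\text{ and } 0<r<\tfrac12 .$$ (2) Let $z_0\in F(u)\cap B_{1/2}$, and suppose that $|\gamma(x)-\gamma(z_0)|\le\omega(|x-z_0|)$ for all $x\in B_1$, where the modulus of continuity $\omega\colon[0,\infty)\to[0,\infty)$ is nondecreasing, $\omega(t)\to0$ as $t\to0^+$, and $\omega$ satisfies the log-Dini condition $$\omega(1)+\limsup_{t\to0^+}\omega(t)\ln\frac1t\ \le\ \tilde C$$ with a constant $\tilde C>0$. Then there are a constant $c^*>0$, depending only on $n,\delta_0,\gamma_0,\tilde C$, and a radius $r_0\in(0,\tfrac12]$, depending only on $n,\delta_0,\gamma_0,\tilde C$ and $\omega$, such that $$\sup_{\partial B_r(z_0)}u\ \ge\ c^*\,r^{\frac{2}{2-\gamma(z_0)}}\qquad\text{for all } 0<r<r_0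 .$$ -/

import Mathlib

open MeasureTheory Filter Topology Set

noncomputable section

namespace VarSing

/-- Euclidean space `ℝⁿ`. -/
abbrev E (n : ℕ) := EuclideanSpace ℝ (Fin n)

variable {n : ℕ}

/-- Smooth functions with compact support in `Ω`. -/
def IsTestFunction (Ω : Set (E n)) (φ : E n → ℝ) : Prop :=
  ContDiff ℝ ((⊤ : ℕ∞) : WithTop ℕ∞) φ ∧ HasCompactSupport φ ∧ tsupport φ ⊆ Ω

/-- `v ∈ H¹(Ω)` and `Dv` is (a version of) its weak gradient: both are square integrable on `Ω`
and `∫_Ω v ∂_e φ = - ∫_Ω ⟨Dv, e⟩ φ` for all test functions `φ` and all directions `e`. -/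
structure HasH1Gradient (Ω : Set (E n)) (v : E n → ℝ) (Dv : E n → E n) : Prop where
  memLp : MemLp v 2 (volume.restrict Ω)
  memLp_grad : MemLp Dv 2 (volume.restrict Ω)
  integral_eq : ∀ φ : E n → ℝ, IsTestFunction Ω φ → ∀ e : E n,
    ∫ x in Ω, v x * fderiv ℝ φ x e = - ∫ x in Ω, inner ℝ (Dv x) e * φ x

/-- The Sobolev space `H¹(Ω)`. -/
def MemH1 (Ω : Set (E n)) (v : E n → ℝ) : Prop :=
  ∃ Dv : E n → E n, HasH1Gradient Ω v Dv

/-- The space `H¹₀(Ω)`: the closure of the test functions in `H¹(Ω)`. -/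
def MemH10 (Ω : Set (E n)) (v : E n → ℝ) : Prop :=
  ∃ Dv : E n → E n, HasH1Gradient Ω v Dv ∧
    ∃ φ : ℕ → E n → ℝ, (∀ k, IsTestFunction Ω (φ k)) ∧
      Tendsto (fun k => eLpNorm (fun x => v x - φ k x) 2 (volume.restrict Ω)) atTop (𝓝 0) ∧
      Tendsto (fun k => eLpNorm (fun x => Dv x - gradient (φ k) x) 2 (volume.restrict Ω))
        atTop (𝓝 0)

/-- The functional `∫_Ω ½ |Dv|² + δ(x) (v⁺)^{γ(x)} dx` of a function `v` with weak
gradient `Dv`. -/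
def energy (δ γ : E n → ℝ) (Ω : Set (E n)) (v : E n → ℝ) (Dv : E n → E n) : ℝ :=
  ∫ x in Ω, ((1 / 2) * ‖Dv x‖ ^ 2 + δ x * (max (v x) 0) ^ (γ x))

/-- Local minimizers of the functional in `Ω` : `u ∈ H¹(Ω)`, and on each open subset `Ω'` of `Ω`
(including `Ω` itself) the energy of `u` is at most that of every `v ∈ H¹(Ω')` with
`v - u ∈ H¹₀(Ω')`. (A weak gradient is unique almost everywhere, so the choice of the versions
`Du`, `Dv` is immaterial.) -/
structure IsLocalMinimizer (δ γ : E n → ℝ) (Ω : Set (E n)) (u : E n → ℝ) : Prop where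
  memH1 : MemH1 Ω u
  energy_le : ∀ Ω' : Set (E n), IsOpen Ω' → Ω' ⊆ Ω →
    ∀ (v : E n → ℝ) (Du Dv : E n → E n),
      HasH1Gradient Ω' u Du → HasH1Gradient Ω' v Dv → MemH10 Ω' (fun x => v x - u x) →
        energy δ γ Ω' u Du ≤ energy δ γ Ω' v Dv

/-- `γ_*(O)`, the essential infimum over `O` (also used for `δ`). -/
def lowerExp (γ : E n → ℝ) (O : Set (E n)) : ℝ := essInf γ (volume.restrict O)

/-- `γ^*(O)`, the essential supremum over `O`. -/
def upperExp (γ : E n → ℝ) (O : Set (E n)) : ℝ := essSup γ (volume.restrict O)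

/-- Standing assumptions on the coefficients in the unit ball: `δ, γ : B₁ → [0, ∞)` are bounded
and (Lebesgue) measurable, and `0 < γ_*(B₁) ≤ γ^*(B₁) ≤ 1`. -/
structure IsAdmissible (δ γ : E n → ℝ) : Prop where
  aemeasurable_delta : AEMeasurable δ (volume.restrict (Metric.ball 0 1))
  aemeasurable_gamma : AEMeasurable γ (volume.restrict (Metric.ball 0 1))
  nonneg_delta : ∀ x ∈ Metric.ball (0 : E n) 1, 0 ≤ δ x
  nonneg_gamma : ∀ x ∈ Metric.ball (0 : E n) 1, 0 ≤ γ x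
  bounded_delta : ∃ K : ℝ, ∀ x ∈ Metric.ball (0 : E n) 1, δ x ≤ K
  bounded_gamma : ∃ K : ℝ, ∀ x ∈ Metric.ball (0 : E n) 1, γ x ≤ K
  lowerExp_pos : 0 < lowerExp γ (Metric.ball 0 1)
  upperExp_le_one : upperExp γ (Metric.ball 0 1) ≤ 1

/-- `u` is a normalized (`0 ≤ u ≤ 1`) local minimizer in the unit ball. -/
structure IsNormalizedMinimizer (δ γ : E n → ℝ) (u : E n → ℝ) : Prop where
  isLocalMinimizer : IsLocalMinimizer δ γ (Metric.ball 0 1) u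
  nonneg : ∀ᵐ x ∂(volume.restrict (Metric.ball (0 : E n) 1)), 0 ≤ u x
  le_one : ∀ᵐ x ∂(volume.restrict (Metric.ball (0 : E n) 1)), u x ≤ 1

/-- The precise representative of (the almost-everywhere class of) `u`, through which the
pointwise values of `u` are read: the limit of the averages of `u` over shrinking balls. At each
point around which `u` has a continuous version it is the value of that version, see
`preciseRep_eq_of_continuousOn`. -/
def preciseRep (u : E n → ℝ) (x : E n) : ℝ :=
  limsup (fun ρ : ℝ => ⨍ z in Metric.ball x ρ, u z) (𝓝[>] 0)

/-- The non-coincidence set `Ω(u) = {x ∈ B₁ : u(x) > 0}`. -/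
def posSet (u : E n → ℝ) : Set (E n) := {x | x ∈ Metric.ball (0 : E n) 1 ∧ 0 < preciseRep u x}

/-- The free boundary `F(u) = ∂Ω(u)`. -/
def freeBoundary (u : E n → ℝ) : Set (E n) := frontier (posSet u)

/-- `sup_{∂B_r(y)} u`. -/
def supSphere (u : E n → ℝ) (y : E n) (r : ℝ) : ℝ :=
  sSup (preciseRep u '' Metric.sphere y r)

/-- Moduli of continuity: nonnegative nondecreasing functions on `[0, ∞)` with limit `0`
at `0⁺`. -/
structure IsModulus (ω : ℝ → ℝ) : Prop where
  nonneg : ∀ t, 0 ≤ t → 0 ≤ ω t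
  mono : MonotoneOn ω (Ici 0)
  tendsto_zero : Tendsto ω (𝓝[>] 0) (𝓝 0)

/-- The log-Dini condition `ω(1) + limsup_{t → 0⁺} ω(t) ln(1/t) ≤ C`; the upper limit is taken in
the extended reals. -/
def LogDini (ω : ℝ → ℝ) (C : ℝ) : Prop :=
  (ω 1 : EReal) + limsup (fun t : ℝ => ((ω t * Real.log (1 / t) : ℝ) : EReal)) (𝓝[>] 0)
    ≤ (C : EReal)

/-- `γ` is continuous at `z` (as a function on the unit ball) with modulus of continuity `ω`. -/
def HasModulusAt (γ : E n → ℝ) (ω : ℝ → ℝ) (z : E n) : Prop :=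
  ∀ x ∈ Metric.ball (0 : E n) 1, |γ x - γ z| ≤ ω (dist x z)

theorem preciseRep_eq_of_continuousOn {u v : E n → ℝ} {Ω : Set (E n)} (hΩ : IsOpen Ω)
    (hv : ContinuousOn v Ω) (huv : u =ᵐ[volume.restrict Ω] v) {x : E n} (hx : x ∈ Ω) :
    preciseRep u x = v x := by
  apply Tendsto.limsup_eq
  rw [Metric.tendsto_nhds]
  intro ε hε
  obtain ⟨s, hs, hsv⟩ := Metric.continuousAt_iff.1 (hv.continuousAt (hΩ.mem_nhds hx)) (ε / 2)
    (half_pos hε)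
  obtain ⟨t, ht, htΩ⟩ := Metric.isOpen_iff.1 hΩ x hx
  filter_upwards [Ioo_mem_nhdsGT (lt_min hs ht)] with ρ hρ
  have hρs : ρ < s := hρ.2.trans_le (min_le_left _ _)
  have hρt : Metric.ball x ρ ⊆ Ω :=
    (Metric.ball_subset_ball (hρ.2.le.trans (min_le_right _ _))).trans htΩ
  have h1 : ⨍ z in Metric.ball x ρ, u z = ⨍ z in Metric.ball x ρ, v z :=
    average_congr (ae_mono (Measure.restrict_mono hρt le_rfl) huv)
  have hmem : ∀ z ∈ Metric.ball x ρ, v z ∈ Metric.closedBall (v x) (ε / 2) := fun z hz =>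
    (hsv ((Metric.mem_ball.1 hz).trans hρs)).le
  have hfin : volume (Metric.ball x ρ) ≠ ⊤ := measure_ball_lt_top.ne
  have hne : volume (Metric.ball x ρ) ≠ 0 := (Metric.measure_ball_pos volume x hρ.1).ne'
  have hbd : IntegrableOn v (Metric.ball x ρ) := by
    refine ⟨(hv.mono hρt).aestronglyMeasurable measurableSet_ball,
      HasFiniteIntegral.restrict_of_bounded (C := ‖v x‖ + ε / 2) hfin.lt_top ?_⟩
    filter_upwards [ae_restrict_mem measurableSet_ball] with z hz
    have := hmem z hz
    rw [Metric.mem_closedBall, dist_eq_norm] at this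
    calc ‖v z‖ = ‖v x + (v z - v x)‖ := by congr 1; ring
      _ ≤ ‖v x‖ + ‖v z - v x‖ := norm_add_le _ _
      _ ≤ _ := by gcongr
  have h2 : ⨍ z in Metric.ball x ρ, v z ∈ Metric.closedBall (v x) (ε / 2) :=
    Convex.set_average_mem (convex_closedBall _ _) Metric.isClosed_closedBall hne hfin
      ((ae_restrict_mem measurableSet_ball).mono hmem) hbd
  rw [h1]
  exact (Metric.mem_closedBall.1 h2).trans_lt (half_lt_self hε)

end VarSing

end

/-! Formally `Δu = δ γ u^{γ - 1}` where `u > 0`. Put `a = γ^*(y, r)` and `w = u^{2 - a} / (2 - a)`.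
Since `0 < u ≤ 1` and `γ ≤ a ≤ 1` in `B_r(y)`, one gets `Δw = (1 - a) u^{-a} |Du|² + δ γ u^{γ - a} ≥
δ₀ γ₀`. If `2 n C < δ₀ γ₀`, then `w - C |x - p|²` is a strict subsolution where `u > 0`. It is
positive at a point `p` with `u(p) > 0`, so it cannot be nonpositive all along `∂B_r(y)`. Hence
`sup_{∂B_r(y)} u^{2 - a} ≥ C (r - |p - y|)²`, and `p` may be taken arbitrarily close to `y`.

No Euler-Lagrange equation is derived. Instead `u` is compared with `u - t (u + κ)^{1 - a} Φ(e)`,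
where `e` is the excess of `(u + κ)^{2 - a} / (2 - a)` over `C |x - p|² + ε` and `Φ` is smooth,
nondecreasing and positive exactly on the positive numbers. The shift `κ` removes the singularity at
`u = 0`, and `ε` confines the variation to `u ≥ κ`. By `potential_variation_le` the potential drops
at rate at least `δ₀ γ₀ Φ(e)`. Together with `IsLocalMinimizer.first_variation` and the identity
`div (x - p) = n`, this gives `(δ₀ γ₀ - 2 n C) ∫ Φ(e) ≤ 0`, so `e ≤ 0` almost everywhere
(`IsNormalizedMinimizer.ae_excess_nonpos`).

Continuity of `u` is not used. Lowering `u` lowers the potential, so `u` is weakly subharmonic and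
satisfies the sub-mean value inequality (`IsNormalizedMinimizer.ae_sub_mean_value`). Its precise
representative is therefore upper semicontinuous, and a strict bound on a sphere becomes an almost
everywhere bound in an annulus. This makes the variation vanish near `∂B_r(y)`, and
`IsChainFunction.hasH10Gradient` places it in `H¹₀`.

For the second claim, `γ^*(z₀, r) ≤ γ(z₀) + ω(r)`, and replacing one exponent by the other costs a
factor `r^{2 ω(r)}`, which the log-Dini condition keeps away from zero. -/

namespace VarSing

noncomputable section

variable {n : ℕ}

/-! ### Mollification of `L²` functions and of weak gradients -/

/-- A standard sequence of bump functions shrinking to the origin. -/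
def bump (n k : ℕ) : ContDiffBump (0 : E n) where
  rIn := 1 / (2 * ((k : ℝ) + 1))
  rOut := 1 / ((k : ℝ) + 1)
  rIn_pos := by positivity
  rIn_lt_rOut := by
    apply one_div_lt_one_div_of_lt <;> nlinarith [Nat.cast_nonneg (α := ℝ) k]

/-- The standard mollifiers. -/
def kernel (n k : ℕ) : E n → ℝ := (bump n k).normed volume

/-- Mollification. -/
def mollify {F : Type*} [NormedAddCommGroup F] [NormedSpace ℝ F] (k : ℕ) (g : E n → F) : E n → F :=
  convolution (kernel n k) g (ContinuousLinearMap.lsmul ℝ ℝ) volume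

theorem tendsto_bump_rOut (n : ℕ) : Tendsto (fun k => (bump n k).rOut) atTop (𝓝 0) :=
  tendsto_one_div_add_atTop_nhds_zero_nat

theorem contDiff_kernel (k : ℕ) {m : ℕ∞} : ContDiff ℝ m (kernel n k) :=
  (bump n k).contDiff_normed

theorem continuous_kernel (k : ℕ) : Continuous (kernel n k) := (bump n k).continuous_normed

theorem hasCompactSupport_kernel (k : ℕ) : HasCompactSupport (kernel n k) :=
  (bump n k).hasCompactSupport_normed

theorem kernel_nonneg (k : ℕ) (x : E n) : 0 ≤ kernel n k x := (bump n k).nonneg_normed x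

theorem integral_kernel (k : ℕ) : ∫ x, kernel n k x = 1 := (bump n k).integral_normed

theorem integrable_kernel (k : ℕ) : Integrable (kernel n k) :=
  (continuous_kernel k).integrable_of_hasCompactSupport (hasCompactSupport_kernel k)

theorem kernel_eq_zero {k : ℕ} {x : E n} (hx : (bump n k).rOut ≤ ‖x‖) : kernel n k x = 0 := by
  have : x ∉ Function.support (kernel n k) := by
    rw [kernel, (bump n k).support_normed_eq]
    simpa using hx
  simpa using this

section
variable {F : Type*} [NormedAddCommGroup F] [NormedSpace ℝ F]

theorem mollify_apply (k : ℕ) (g : E n → F) (x : E n) :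
    mollify k g x = ∫ t, kernel n k t • g (x - t) := rfl

theorem mollify_apply_swap (k : ℕ) (g : E n → F) (x : E n) :
    mollify k g x = ∫ z, kernel n k (x - z) • g z := by
  rw [mollify, convolution_eq_swap]
  rfl

theorem integrable_kernel_smul {g : E n → F} (hg : LocallyIntegrable g) (k : ℕ) (x : E n) :
    Integrable (fun t => kernel n k t • g (x - t)) :=
  ((hasCompactSupport_kernel k).convolutionExists_left (ContinuousLinearMap.lsmul ℝ ℝ)
    (continuous_kernel k) hg x)

theorem contDiff_mollify {g : E n → F} (hg : LocallyIntegrable g) (k : ℕ) :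
    ContDiff ℝ ((⊤ : ℕ∞) : WithTop ℕ∞) (mollify k g) :=
  (hasCompactSupport_kernel k).contDiff_convolution_left _ (contDiff_kernel k) hg

theorem ae_tendsto_mollify [CompleteSpace F] {g : E n → F} (hg : LocallyIntegrable g) :
    ∀ᵐ x, Tendsto (fun k => mollify k g x) atTop (𝓝 (g x)) :=
  -- Lebesgue differentiation needs the two radii of the bumps to stay comparable; here `rOut = 2 *
  -- rIn`.
  ContDiffBump.ae_convolution_tendsto_right_of_locallyIntegrable (K := 2) (tendsto_bump_rOut n)
    (Eventually.of_forall fun k => le_of_eq (by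
      show 1 / ((k : ℝ) + 1) = 2 * (1 / (2 * ((k : ℝ) + 1)))
      field_simp)) hg

omit [NormedSpace ℝ F] in
theorem eLpNorm_two_eq_lintegral {α : Type*} [MeasurableSpace α] {μ : Measure α} (f : α → F) :
    eLpNorm f 2 μ = (∫⁻ x, ‖f x‖ₑ ^ (2 : ℝ) ∂μ) ^ (1 / 2 : ℝ) := by
  rw [eLpNorm_eq_lintegral_rpow_enorm_toReal (by norm_num) (by norm_num)]
  norm_num

theorem lintegral_kernel (k : ℕ) : ∫⁻ t, ENNReal.ofReal (kernel n k t) = 1 := by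
  rw [← ofReal_integral_eq_lintegral_ofReal (integrable_kernel k)
    (Eventually.of_forall (kernel_nonneg k)), integral_kernel, ENNReal.ofReal_one]

/-- Jensen's inequality: the kernel is a probability density, and for a probability measure the `L¹`
norm is at most the `L²` norm. -/
theorem enorm_mollify_sq_le {g : E n → F} (hg : AEStronglyMeasurable g) (k : ℕ) (x : E n) :
    ‖mollify k g x‖ₑ ^ (2 : ℝ) ≤
      ∫⁻ t, ENNReal.ofReal (kernel n k t) * ‖g (x - t)‖ₑ ^ (2 : ℝ) := by
  set π := (volume : Measure (E n)).withDensity fun t => ENNReal.ofReal (kernel n k t) with hπ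
  have hmk : Measurable fun t => ENNReal.ofReal (kernel n k t) :=
    (continuous_kernel k).measurable.ennreal_ofReal
  have : IsProbabilityMeasure π := ⟨by
    rw [hπ, withDensity_apply _ MeasurableSet.univ, Measure.restrict_univ, lintegral_kernel]⟩
  have hgx : AEStronglyMeasurable (fun t => g (x - t)) :=
    hg.comp_quasiMeasurePreserving (quasiMeasurePreserving_sub_left volume x)
  have hgπ : AEStronglyMeasurable (fun t => g (x - t)) π :=
    hgx.mono_ac (withDensity_absolutelyContinuous _ _)
  have h1 : ‖mollify k g x‖ₑ ≤ eLpNorm (fun t => g (x - t)) 1 π := by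
    rw [mollify_apply, eLpNorm_one_eq_lintegral_enorm, hπ,
      lintegral_withDensity_eq_lintegral_mul₀ hmk.aemeasurable hgx.enorm]
    refine (enorm_integral_le_lintegral_enorm _).trans (lintegral_mono fun t => ?_)
    rw [enorm_smul, Real.enorm_of_nonneg (kernel_nonneg k t)]
    rfl
  have h2 := h1.trans (eLpNorm_le_eLpNorm_of_exponent_le (by norm_num : (1 : ENNReal) ≤ 2) hgπ)
  rw [eLpNorm_two_eq_lintegral] at h2
  have h3 := ENNReal.rpow_le_rpow h2 (by norm_num : (0 : ℝ) ≤ 2)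
  rw [← ENNReal.rpow_mul] at h3
  norm_num at h3
  have h4 := lintegral_withDensity_eq_lintegral_mul₀ hmk.aemeasurable
    (hgx.enorm.pow_const (2 : ℝ))
  rw [← hπ] at h4
  norm_num at h4 ⊢
  rw [h4] at h3
  exact h3

/-- Mollification is a contraction of `L²`. -/
theorem eLpNorm_mollify_le {g : E n → F} (hg : AEStronglyMeasurable g) (k : ℕ) :
    eLpNorm (mollify k g) 2 volume ≤ eLpNorm g 2 volume := by
  rw [eLpNorm_two_eq_lintegral, eLpNorm_two_eq_lintegral]
  refine ENNReal.rpow_le_rpow ?_ (by norm_num)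
  calc ∫⁻ x, ‖mollify k g x‖ₑ ^ (2 : ℝ)
      ≤ ∫⁻ x, ∫⁻ t, ENNReal.ofReal (kernel n k t) * ‖g (x - t)‖ₑ ^ (2 : ℝ) :=
        lintegral_mono fun x => enorm_mollify_sq_le hg k x
    _ = ∫⁻ t, ∫⁻ x, ENNReal.ofReal (kernel n k t) * ‖g (x - t)‖ₑ ^ (2 : ℝ) := by
        refine lintegral_lintegral_swap (AEMeasurable.mul ?_ ?_)
        · exact ((continuous_kernel k).measurable.ennreal_ofReal.comp measurable_snd).aemeasurable
        · exact ((hg.comp_quasiMeasurePreserving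
            (quasiMeasurePreserving_sub volume volume)).enorm).pow_const _
    _ = ∫⁻ t, ENNReal.ofReal (kernel n k t) * ∫⁻ x, ‖g x‖ₑ ^ (2 : ℝ) := by
        refine lintegral_congr fun t => ?_
        rw [lintegral_const_mul' _ _ ENNReal.ofReal_ne_top,
          lintegral_sub_right_eq_self (fun x => ‖g x‖ₑ ^ (2 : ℝ))]
    _ = ∫⁻ x, ‖g x‖ₑ ^ (2 : ℝ) := by
        rw [lintegral_mul_const'' _
          (continuous_kernel k).measurable.ennreal_ofReal.aemeasurable, lintegral_kernel, one_mul]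

theorem mollify_sub {g h : E n → F} (hg : LocallyIntegrable g) (hh : LocallyIntegrable h) (k : ℕ) :
    mollify k (g - h) = mollify k g - mollify k h := by
  ext x
  simp only [mollify_apply, Pi.sub_apply, smul_sub]
  exact integral_sub (integrable_kernel_smul hg k x) (integrable_kernel_smul hh k x)

/-- By uniform continuity the difference is uniformly small, and it lives in one fixed ball because
all kernels are supported in the closed unit ball. The general `L²` case follows by density and
contractivity. -/
theorem tendsto_eLpNorm_mollify_sub_of_continuous [CompleteSpace F] {g : E n → F}
    (hg : Continuous g) (hc : HasCompactSupport g) :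
    Tendsto (fun k => eLpNorm (mollify k g - g) 2 volume) atTop (𝓝 0) := by
  obtain ⟨R, hR⟩ := hc.isCompact.isBounded.subset_closedBall (0 : E n)
  set S := Metric.closedBall (0 : E n) (R + 1) with hS
  have hz : ∀ k x, x ∉ S → mollify k g x - g x = 0 := by
    intro k x hx
    have hx' : R + 1 < ‖x‖ := by simpa [hS] using hx
    have hout : ∀ z : E n, dist z x < 1 → g z = 0 := by
      intro z hz
      by_contra h0
      have h1 : z ∈ Metric.closedBall (0 : E n) R := hR (subset_tsupport _ h0)
      have h2 : ‖x‖ ≤ ‖z‖ + dist z x := by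
        rw [dist_eq_norm]
        calc ‖x‖ = ‖z - (z - x)‖ := by congr 1; abel
          _ ≤ _ := norm_sub_le _ _
      have h3 : ‖z‖ ≤ R := by simpa using h1
      linarith
    have hgx := hout x (by simp)
    have hr : (bump n k).rOut ≤ 1 := by
      show 1 / ((k : ℝ) + 1) ≤ 1
      rw [div_le_one (by positivity)]
      linarith [Nat.cast_nonneg (α := ℝ) k]
    have : mollify k g x = g x := by
      refine (bump n k).normed_convolution_eq_right fun z hz => ?_
      rw [hgx, hout z (lt_of_lt_of_le hz hr)]
    rw [this, sub_self]
  have huc := hc.uniformContinuous_of_continuous hg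
  have hSfin : volume S ≠ ⊤ := measure_closedBall_lt_top.ne
  rw [ENNReal.tendsto_nhds_zero]
  intro ε hε
  set V := (volume S) ^ (1 / 2 : ℝ) with hV
  have hVfin : V ≠ ⊤ := ENNReal.rpow_ne_top_of_nonneg (by norm_num) hSfin
  obtain ⟨η, hη, hηε⟩ : ∃ η : ℝ, 0 < η ∧ V * ENNReal.ofReal η ≤ ε := by
    have : Tendsto (fun η : ℝ => V * ENNReal.ofReal η) (𝓝[>] 0) (𝓝 (V * ENNReal.ofReal 0)) := by
      refine ENNReal.Tendsto.const_mul ?_ (Or.inr hVfin)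
      exact (ENNReal.continuous_ofReal.tendsto 0).mono_left nhdsWithin_le_nhds
    rw [ENNReal.ofReal_zero, mul_zero] at this
    have h := (this.eventually (ge_mem_nhds hε)).and self_mem_nhdsWithin
    obtain ⟨η, h1, h2⟩ := h.exists
    exact ⟨η, h2, h1⟩
  obtain ⟨d, hd, hdη⟩ := Metric.uniformContinuous_iff.1 huc η hη
  filter_upwards [(tendsto_bump_rOut n).eventually (gt_mem_nhds hd)] with k hk
  have hb : ∀ x, ‖mollify k g x - g x‖ ≤ η := by
    intro x
    rw [← dist_eq_norm]
    exact (bump n k).dist_normed_convolution_le hg.aestronglyMeasurable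
      fun z hz => (hdη (lt_trans hz hk)).le
  have h1 : eLpNorm (mollify k g - g) 2 volume
      = eLpNorm (mollify k g - g) 2 (volume.restrict S) := by
    have : S.indicator (mollify k g - g) = mollify k g - g :=
      indicator_eq_self.2 fun x hx => by_contra fun h => hx (hz k x h)
    rw [← eLpNorm_indicator_eq_eLpNorm_restrict (s := S) Metric.isClosed_closedBall.measurableSet,
      this]
  rw [h1]
  refine (eLpNorm_le_of_ae_bound (C := η) (Eventually.of_forall hb)).trans ?_
  rw [Measure.restrict_apply_univ]
  refine le_trans (le_of_eq ?_) hηε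
  norm_num [hV]

/-- Mollifications of an `L²` function converge to it in `L²`. -/
theorem tendsto_eLpNorm_mollify_sub [CompleteSpace F] {g : E n → F} (hg : MemLp g 2 volume) :
    Tendsto (fun k => eLpNorm (mollify k g - g) 2 volume) atTop (𝓝 0) := by
  rw [ENNReal.tendsto_nhds_zero]
  intro ε hε
  have hε3 : ε / 3 ≠ 0 := (ENNReal.div_pos hε.ne' (by norm_num)).ne'
  obtain ⟨h, hhc, hgh, hcont, hh⟩ :=
    hg.exists_hasCompactSupport_eLpNorm_sub_le (by norm_num) hε3
  have hgl := hg.locallyIntegrable (by norm_num)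
  have hhl := hh.locallyIntegrable (by norm_num)
  have h0 := ENNReal.tendsto_nhds_zero.1 (tendsto_eLpNorm_mollify_sub_of_continuous hcont hhc)
    (ε / 3) hε3.bot_lt
  filter_upwards [h0] with k hk
  have hmk : ∀ f : E n → F, LocallyIntegrable f → AEStronglyMeasurable (mollify k f) :=
    fun f hf => (contDiff_mollify hf k).continuous.aestronglyMeasurable
  have e : mollify k g - g = (mollify k (g - h) + (mollify k h - h)) + (h - g) := by
    rw [mollify_sub hgl hhl]
    abel
  have hsub : LocallyIntegrable (g - h) := hgl.sub hhl
  rw [e]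
  calc _ ≤ eLpNorm (mollify k (g - h) + (mollify k h - h)) 2 volume + eLpNorm (h - g) 2 volume :=
        eLpNorm_add_le ((hmk _ hsub).add ((hmk _ hhl).sub hh.1)) (hh.1.sub hg.1) (by norm_num)
    _ ≤ (eLpNorm (mollify k (g - h)) 2 volume + eLpNorm (mollify k h - h) 2 volume)
          + eLpNorm (h - g) 2 volume := by
        gcongr
        exact eLpNorm_add_le (hmk _ hsub) ((hmk _ hhl).sub hh.1) (by norm_num)
    _ ≤ (ε / 3 + ε / 3) + ε / 3 := by
        gcongr
        · exact (eLpNorm_mollify_le (hg.1.sub hh.1) k).trans hgh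
        · rw [eLpNorm_sub_comm]
          exact hgh
    _ = ε := ENNReal.add_thirds ε

end

/-- Mollification commutes with weak differentiation away from the boundary. -/
theorem hasGradientAt_mollify {Ω : Set (E n)} {u : E n → ℝ} {Du : E n → E n}
    (h : HasH1Gradient Ω u Du) (hΩ : MeasurableSet Ω) {k : ℕ} {x : E n}
    (hx : Metric.closedBall x (bump n k).rOut ⊆ Ω) :
    HasGradientAt (mollify k (Ω.indicator u)) (mollify k (Ω.indicator Du) x) x := by
  have hu : LocallyIntegrable (Ω.indicator u) :=
    ((memLp_indicator_iff_restrict hΩ).2 h.memLp).locallyIntegrable (by norm_num)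
  have hDu : LocallyIntegrable (Ω.indicator Du) :=
    ((memLp_indicator_iff_restrict hΩ).2 h.memLp_grad).locallyIntegrable (by norm_num)
  have h1 := (hasCompactSupport_kernel (n := n) k).hasFDerivAt_convolution_left
    (ContinuousLinearMap.lsmul ℝ ℝ) ((contDiff_kernel k (m := 1))) hu x
  rw [hasGradientAt_iff_hasFDerivAt]
  refine h1.congr_fderiv ?_
  ext e
  have hfc : Continuous (fderiv ℝ (kernel n k)) := (contDiff_kernel k (m := 1)).continuous_fderiv
    (by norm_num)
  have hex := (hasCompactSupport_kernel (n := n) k).fderiv (𝕜 := ℝ) |>.convolutionExists_left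
    (ContinuousLinearMap.precompL (E n) (ContinuousLinearMap.lsmul ℝ ℝ : ℝ →L[ℝ] ℝ →L[ℝ] ℝ))
    hfc hu x
  -- The reflected kernel is an admissible test function precisely because its support ball lies in
  -- `Ω`. The sign from differentiating in `z` cancels the one in the weak formulation.
  have hφ : IsTestFunction Ω (fun z => kernel n k (x - z)) := by
    have hts : tsupport (fun z => kernel n k (x - z)) ⊆ Metric.closedBall x (bump n k).rOut := by
      refine closure_minimal (fun z hz => ?_) Metric.isClosed_closedBall
      by_contra hz'
      refine hz (kernel_eq_zero ?_)
      rw [Metric.mem_closedBall, dist_eq_norm, norm_sub_rev, not_le] at hz'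
      exact hz'.le
    refine ⟨(contDiff_kernel k).comp (contDiff_const.sub contDiff_id), ?_, hts.trans hx⟩
    exact HasCompactSupport.of_support_subset_isCompact (isCompact_closedBall x _)
      ((subset_tsupport _).trans hts)
  have h2 := h.integral_eq _ hφ e
  have hder : ∀ z, fderiv ℝ (fun z => kernel n k (x - z)) z e = - fderiv ℝ (kernel n k) (x - z) e := by
    intro z
    have := ((contDiff_kernel (n := n) k (m := 1)).differentiable (by norm_num) (x - z)).hasFDerivAt.comp z
      ((hasFDerivAt_id z).const_sub x)
    have h' : fderiv ℝ (fun z => kernel n k (x - z)) z = _ := this.fderiv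
    rw [h']
    simp
  rw [convolution_eq_swap]
  have hint : Integrable (fun t => (ContinuousLinearMap.precompL (E n)
      (ContinuousLinearMap.lsmul ℝ ℝ : ℝ →L[ℝ] ℝ →L[ℝ] ℝ)) (fderiv ℝ (kernel n k) (x - t))
      (Ω.indicator u t)) := hex.integrable_swap
  rw [ContinuousLinearMap.integral_apply hint]
  have hint2 : Integrable (fun z => kernel n k (x - z) • Ω.indicator Du z) := by
    have := ((hasCompactSupport_kernel (n := n) k).convolutionExists_left
      (ContinuousLinearMap.lsmul ℝ ℝ) (continuous_kernel k) hDu x).integrable_swap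
    exact this
  rw [mollify_apply_swap, InnerProductSpace.toDual_apply_apply, real_inner_comm,
    ← integral_inner hint2]
  have e1 : ∀ t, (ContinuousLinearMap.precompL (E n)
      (ContinuousLinearMap.lsmul ℝ ℝ : ℝ →L[ℝ] ℝ →L[ℝ] ℝ)) (fderiv ℝ (kernel n k) (x - t))
      (Ω.indicator u t) e = Ω.indicator (fun t => -(u t *
        fderiv ℝ (fun z => kernel n k (x - z)) t e)) t := by
    intro t
    rw [ContinuousLinearMap.precompL_apply]
    by_cases ht : t ∈ Ω
    · simp [ht, hder, mul_comm]
    · simp [ht]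
  have e2 : ∀ z, inner ℝ e (kernel n k (x - z) • Ω.indicator Du z)
      = Ω.indicator (fun z => inner ℝ (Du z) e * kernel n k (x - z)) z := by
    intro z
    by_cases hz : z ∈ Ω
    · simp [hz, inner_smul_right, real_inner_comm, mul_comm]
    · simp [hz]
  simp_rw [e1, e2]
  rw [integral_indicator hΩ, integral_indicator hΩ, integral_neg, h2, neg_neg]

theorem integral_kernel_sub (k : ℕ) (x : E n) : ∫ z, kernel n k (x - z) = 1 := by
  rw [integral_sub_left_eq_self (kernel n k) volume x, integral_kernel]

theorem mollify_le {g : E n → ℝ} (hg : LocallyIntegrable g) {k : ℕ} {x : E n} {M : ℝ}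
    (h : ∀ᵐ z, z ∈ Metric.ball x (bump n k).rOut → g z ≤ M) : mollify k g x ≤ M := by
  have hint : Integrable (fun z => kernel n k (x - z) • g z) :=
    ((hasCompactSupport_kernel (n := n) k).convolutionExists_left
      (ContinuousLinearMap.lsmul ℝ ℝ) (continuous_kernel k) hg x).integrable_swap
  rw [mollify_apply_swap]
  calc ∫ z, kernel n k (x - z) • g z ≤ ∫ z, kernel n k (x - z) * M := by
        refine integral_mono_ae hint (((integrable_kernel k).comp_sub_left x).mul_const M) ?_
        filter_upwards [h] with z hz
        by_cases hzx : z ∈ Metric.ball x (bump n k).rOut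
        · exact mul_le_mul_of_nonneg_left (hz hzx) (kernel_nonneg _ _)
        · rw [Metric.mem_ball, dist_comm, dist_eq_norm, not_lt] at hzx
          simp [kernel_eq_zero hzx]
    _ = M := by rw [integral_mul_const, integral_kernel_sub, one_mul]

theorem mollify_nonneg {g : E n → ℝ} (h : ∀ᵐ z, 0 ≤ g z) (k : ℕ) (x : E n) : 0 ≤ mollify k g x := by
  rw [mollify_apply_swap]
  refine integral_nonneg_of_ae ?_
  filter_upwards [h] with z hz
  exact mul_nonneg (kernel_nonneg _ _) hz

/-! ### `L²` pairings, test functions and calculus of weak gradients -/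

section
variable {F : Type*} [NormedAddCommGroup F] [InnerProductSpace ℝ F]

theorem integrable_inner_of_memLp {α : Type*} [MeasurableSpace α] {μ : Measure α} {f g : α → F}
    (hf : MemLp f 2 μ) (hg : MemLp g 2 μ) : Integrable (fun x => inner ℝ (f x) (g x)) μ := by
  have h := hf.norm.integrable_mul hg.norm
  exact h.mono' (hf.1.inner hg.1) (Eventually.of_forall fun x => norm_inner_le_norm _ _)

/-- Cauchy-Schwarz. This transfers integral identities from test functions to their `H¹₀` limits. -/
theorem tendsto_integral_inner {α : Type*} [MeasurableSpace α] {μ : Measure α} {f : α → F}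
    {fk : ℕ → α → F} {g : α → F} (hf : MemLp f 2 μ) (hfk : ∀ k, MemLp (fk k) 2 μ) (hg : MemLp g 2 μ)
    (h : Tendsto (fun k => eLpNorm (fun x => f x - fk k x) 2 μ) atTop (𝓝 0)) :
    Tendsto (fun k => ∫ x, inner ℝ (fk k x) (g x) ∂μ) atTop (𝓝 (∫ x, inner ℝ (f x) (g x) ∂μ)) := by
  rw [tendsto_iff_edist_tendsto_0]
  have hb : ∀ k, edist (∫ x, inner ℝ (fk k x) (g x) ∂μ) (∫ x, inner ℝ (f x) (g x) ∂μ)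
      ≤ eLpNorm (fun x => f x - fk k x) 2 μ * eLpNorm g 2 μ := by
    intro k
    rw [edist_comm, edist_eq_enorm_sub, ← integral_sub (integrable_inner_of_memLp hf hg)
      (integrable_inner_of_memLp (hfk k) hg)]
    refine (enorm_integral_le_lintegral_enorm _).trans ?_
    have hle : ∀ x, ‖inner ℝ (f x) (g x) - inner ℝ (fk k x) (g x)‖ₑ
        ≤ ‖f x - fk k x‖ₑ * ‖g x‖ₑ := by
      intro x
      rw [← inner_sub_left]
      rw [← ofReal_norm, ← ofReal_norm, ← ofReal_norm,
        ← ENNReal.ofReal_mul (norm_nonneg _)]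
      exact ENNReal.ofReal_le_ofReal (norm_inner_le_norm _ _)
    refine (lintegral_mono hle).trans ?_
    rw [eLpNorm_two_eq_lintegral, eLpNorm_two_eq_lintegral]
    exact ENNReal.lintegral_mul_le_Lp_mul_Lq μ Real.HolderConjugate.two_two
      (hf.1.sub (hfk k).1).enorm hg.1.enorm
  have h0 : Tendsto (fun k => eLpNorm (fun x => f x - fk k x) 2 μ * eLpNorm g 2 μ) atTop (𝓝 0) := by
    have := ENNReal.Tendsto.mul_const h (Or.inr hg.2.ne)
    rwa [zero_mul] at this
  exact tendsto_of_tendsto_of_tendsto_of_le_of_le tendsto_const_nhds h0 (fun _ => zero_le) hb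

end

theorem inner_gradient (φ : E n → ℝ) (x e : E n) :
    inner ℝ (gradient φ x) e = fderiv ℝ φ x e := by
  rw [gradient, ← InnerProductSpace.toDual_apply_apply (𝕜 := ℝ), LinearIsometryEquiv.apply_symm_apply]

namespace IsTestFunction

variable {Ω Ω' : Set (E n)} {φ ψ : E n → ℝ}

theorem mono (h : IsTestFunction Ω φ) (hs : Ω ⊆ Ω') : IsTestFunction Ω' φ :=
  ⟨h.1, h.2.1, h.2.2.trans hs⟩

theorem eq_zero (h : IsTestFunction Ω φ) {x : E n} (hx : x ∉ Ω) : φ x = 0 :=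
  image_eq_zero_of_notMem_tsupport fun h' => hx (h.2.2 h')

theorem fderiv_eq_zero (h : IsTestFunction Ω φ) {x : E n} (hx : x ∉ Ω) : fderiv ℝ φ x = 0 :=
  image_eq_zero_of_notMem_tsupport fun h' => hx (h.2.2 (tsupport_fderiv_subset ℝ h'))

theorem differentiable (h : IsTestFunction Ω φ) : Differentiable ℝ φ :=
  h.1.differentiable (by simp)

theorem continuous_fderiv (h : IsTestFunction Ω φ) : Continuous (fderiv ℝ φ) :=
  h.1.continuous_fderiv (by simp)

theorem continuous_gradient (h : IsTestFunction Ω φ) : Continuous (gradient φ) :=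
  (InnerProductSpace.toDual ℝ (E n)).symm.continuous.comp h.continuous_fderiv

theorem memLp (h : IsTestFunction Ω φ) (μ : Measure (E n)) [IsFiniteMeasureOnCompacts μ] :
    MemLp φ 2 μ :=
  h.1.continuous.memLp_of_hasCompactSupport h.2.1

theorem memLp_gradient (h : IsTestFunction Ω φ) (μ : Measure (E n)) [IsFiniteMeasureOnCompacts μ] :
    MemLp (gradient φ) 2 μ := by
  refine h.continuous_gradient.memLp_of_hasCompactSupport ?_
  exact (h.2.1.fderiv (𝕜 := ℝ)).comp_left (map_zero _)

theorem memLp_fderiv (h : IsTestFunction Ω φ) (e : E n) (μ : Measure (E n))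
    [IsFiniteMeasureOnCompacts μ] : MemLp (fun x => fderiv ℝ φ x e) 2 μ :=
  (h.continuous_fderiv.clm_apply continuous_const).memLp_of_hasCompactSupport
    (h.2.1.fderiv_apply (𝕜 := ℝ) e)

theorem setIntegral_mul_fderiv (h : IsTestFunction Ω φ) (hψ : ContDiff ℝ 1 ψ) (e : E n) :
    ∫ x in Ω, ψ x * fderiv ℝ φ x e = - ∫ x in Ω, fderiv ℝ ψ x e * φ x := by
  have hψd : Continuous fun x => fderiv ℝ ψ x e :=
    (hψ.continuous_fderiv (by norm_num)).clm_apply continuous_const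
  have hφd : Continuous fun x => fderiv ℝ φ x e := h.continuous_fderiv.clm_apply continuous_const
  rw [setIntegral_eq_integral_of_forall_compl_eq_zero, setIntegral_eq_integral_of_forall_compl_eq_zero]
  · refine integral_mul_fderiv_eq_neg_fderiv_mul_of_integrable ?_ ?_ ?_ ?_ ?_
    · exact (hψd.mul h.1.continuous).integrable_of_hasCompactSupport h.2.1.mul_left
    · exact (hψ.continuous.mul hφd).integrable_of_hasCompactSupport
        (h.2.1.fderiv_apply (𝕜 := ℝ) e).mul_left
    · exact (hψ.continuous.mul h.1.continuous).integrable_of_hasCompactSupport h.2.1.mul_left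
    · exact fun x _ => hψ.differentiable (by norm_num) x
    · exact fun x _ => h.differentiable x
  · intro x hx
    rw [h.eq_zero hx, mul_zero]
  · intro x hx
    rw [h.fderiv_eq_zero hx]
    simp

theorem hasH1Gradient (h : IsTestFunction Ω φ) : HasH1Gradient Ω φ (gradient φ) := by
  refine ⟨h.memLp _, h.memLp_gradient _, fun ψ hψ e => ?_⟩
  simp_rw [inner_gradient]
  exact hψ.setIntegral_mul_fderiv (h.1.of_le (by exact_mod_cast le_top)) e

end IsTestFunction

namespace HasH1Gradient

variable {Ω Ω' : Set (E n)} {u v : E n → ℝ} {Du Dv : E n → E n}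

theorem mono (h : HasH1Gradient Ω u Du) (hs : Ω' ⊆ Ω) (hΩ : MeasurableSet Ω) :
    HasH1Gradient Ω' u Du := by
  refine ⟨h.memLp.mono_measure (Measure.restrict_mono hs le_rfl),
    h.memLp_grad.mono_measure (Measure.restrict_mono hs le_rfl), fun φ hφ e => ?_⟩
  have h1 := h.integral_eq φ (hφ.mono hs) e
  rwa [setIntegral_eq_of_subset_of_forall_sdiff_eq_zero hΩ hs,
    setIntegral_eq_of_subset_of_forall_sdiff_eq_zero hΩ hs] at h1
  · intro x hx
    rw [hφ.eq_zero hx.2, mul_zero]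
  · intro x hx
    rw [hφ.fderiv_eq_zero hx.2]
    simp

theorem add (hu : HasH1Gradient Ω u Du) (hv : HasH1Gradient Ω v Dv) :
    HasH1Gradient Ω (fun x => u x + v x) (fun x => Du x + Dv x) := by
  refine ⟨hu.memLp.add hv.memLp, hu.memLp_grad.add hv.memLp_grad, fun φ hφ e => ?_⟩
  have i1 : ∀ {w : E n → ℝ} {Dw : E n → E n}, HasH1Gradient Ω w Dw →
      Integrable (fun x => w x * fderiv ℝ φ x e) (volume.restrict Ω) := fun hw =>
    hw.memLp.integrable_mul (hφ.memLp_fderiv e _)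
  have i2 : ∀ {w : E n → ℝ} {Dw : E n → E n}, HasH1Gradient Ω w Dw →
      Integrable (fun x => inner ℝ (Dw x) e * φ x) (volume.restrict Ω) := fun hw =>
    (hw.memLp_grad.inner_const e).integrable_mul (hφ.memLp _)
  simp_rw [inner_add_left, add_mul]
  rw [integral_add (i1 hu) (i1 hv), integral_add (i2 hu) (i2 hv), hu.integral_eq φ hφ e,
    hv.integral_eq φ hφ e]
  ring

theorem const_smul (hu : HasH1Gradient Ω u Du) (c : ℝ) :
    HasH1Gradient Ω (fun x => c * u x) (fun x => c • Du x) := by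
  refine ⟨hu.memLp.const_mul c, hu.memLp_grad.const_smul c, fun φ hφ e => ?_⟩
  simp_rw [real_inner_smul_left, mul_assoc]
  rw [integral_const_mul, integral_const_mul, hu.integral_eq φ hφ e]
  ring

/-- Both sides of the weak gradient identity are `L²` pairings with a fixed function, so the weak
gradient is a closed operator. -/
theorem of_tendsto (hv : MemLp v 2 (volume.restrict Ω)) (hDv : MemLp Dv 2 (volume.restrict Ω))
    {φ : ℕ → E n → ℝ} (hφ : ∀ k, IsTestFunction Ω (φ k))
    (h1 : Tendsto (fun k => eLpNorm (fun x => v x - φ k x) 2 (volume.restrict Ω)) atTop (𝓝 0))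
    (h2 : Tendsto (fun k => eLpNorm (fun x => Dv x - gradient (φ k) x) 2 (volume.restrict Ω))
        atTop (𝓝 0)) : HasH1Gradient Ω v Dv := by
  refine ⟨hv, hDv, fun ψ hψ e => ?_⟩
  have t1 := tendsto_integral_inner hv (fun k => (hφ k).memLp _) (hψ.memLp_fderiv e _) h1
  have hψe : MemLp (fun x => ψ x • e) 2 (volume.restrict Ω) :=
    (hψ.1.continuous.smul continuous_const).memLp_of_hasCompactSupport (hψ.2.1.smul_right)
  have t2 := tendsto_integral_inner hDv (fun k => (hφ k).memLp_gradient _) hψe h2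
  have e1 : ∀ w : E n → ℝ, (fun x => inner ℝ (w x) (fderiv ℝ ψ x e))
      = fun x => w x * fderiv ℝ ψ x e := fun w => by
    ext x
    simp [mul_comm]
  have e2 : ∀ w : E n → E n, (fun x => inner ℝ (w x) (ψ x • e))
      = fun x => inner ℝ (w x) e * ψ x := fun w => by
    ext x
    rw [real_inner_smul_right, mul_comm]
  simp_rw [e1] at t1
  simp_rw [e2] at t2
  refine tendsto_nhds_unique t1 ?_
  simp_rw [fun k => (hφ k).hasH1Gradient.integral_eq ψ hψ e]
  exact t2.neg

end HasH1Gradient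

/-- `v ∈ H¹₀(Ω)` with weak gradient `Dv`. -/
structure HasH10Gradient (Ω : Set (E n)) (v : E n → ℝ) (Dv : E n → E n) : Prop where
  hasH1Gradient : HasH1Gradient Ω v Dv
  exists_approx : ∃ φ : ℕ → E n → ℝ, (∀ k, IsTestFunction Ω (φ k)) ∧
      Tendsto (fun k => eLpNorm (fun x => v x - φ k x) 2 (volume.restrict Ω)) atTop (𝓝 0) ∧
      Tendsto (fun k => eLpNorm (fun x => Dv x - gradient (φ k) x) 2 (volume.restrict Ω))
        atTop (𝓝 0)

theorem IsTestFunction.const_mul {Ω : Set (E n)} {φ : E n → ℝ} (h : IsTestFunction Ω φ) (c : ℝ) :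
    IsTestFunction Ω (fun x => c * φ x) :=
  ⟨contDiff_const.mul h.1, h.2.1.mul_left,
    (closure_mono (Function.support_mul_subset_right (fun _ => c) φ)).trans h.2.2⟩

theorem IsTestFunction.hasH10Gradient {Ω : Set (E n)} {φ : E n → ℝ} (h : IsTestFunction Ω φ) :
    HasH10Gradient Ω φ (gradient φ) :=
  ⟨h.hasH1Gradient, fun _ => φ, fun _ => h, by simp, by simp⟩

theorem HasH10Gradient.const_mul {Ω : Set (E n)} {v : E n → ℝ} {Dv : E n → E n}
    (h : HasH10Gradient Ω v Dv) (c : ℝ) :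
    HasH10Gradient Ω (fun x => c * v x) (fun x => c • Dv x) := by
  obtain ⟨φ, hφ, h1, h2⟩ := h.exists_approx
  refine ⟨h.hasH1Gradient.const_smul c, fun k x => c * φ k x, fun k => (hφ k).const_mul c, ?_, ?_⟩
  · have e : ∀ k, eLpNorm (fun x => c * v x - c * φ k x) 2 (volume.restrict Ω)
        = ‖c‖ₑ * eLpNorm (fun x => v x - φ k x) 2 (volume.restrict Ω) := fun k => by
      rw [← eLpNorm_const_smul]
      congr 1
      ext x
      simp [mul_sub]
    simp_rw [e]
    have := ENNReal.Tendsto.const_mul (a := ‖c‖ₑ) h1 (Or.inr enorm_ne_top)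
    rwa [mul_zero] at this
  · have g : ∀ k x, gradient (fun x => c * φ k x) x = c • gradient (φ k) x := fun k x => by
      rw [gradient, gradient, fderiv_const_mul ((hφ k).differentiable x), map_smul]
    have e : ∀ k, eLpNorm (fun x => c • Dv x - gradient (fun x => c * φ k x) x) 2 (volume.restrict Ω)
        = ‖c‖ₑ * eLpNorm (fun x => Dv x - gradient (φ k) x) 2 (volume.restrict Ω) := fun k => by
      rw [← eLpNorm_const_smul]
      congr 1
      ext x
      simp [g, smul_sub]
    simp_rw [e]
    have := ENNReal.Tendsto.const_mul (a := ‖c‖ₑ) h2 (Or.inr enorm_ne_top)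
    rwa [mul_zero] at this

/-! ### First variation and weak subharmonicity -/

instance isFiniteMeasure_restrict_ball (x : E n) (r : ℝ) :
    IsFiniteMeasure (volume.restrict (Metric.ball x r)) :=
  ⟨by rw [Measure.restrict_apply_univ]; exact measure_ball_lt_top⟩

/-- First-variation inequality for local minimizers: if lowering `u` by `t ζ` lowers the potential
term by at least `t g`, then `∫ ⟨Du, Dζ⟩ + ∫ g ≤ 0`. -/
theorem IsLocalMinimizer.first_variation {δ γ u : E n → ℝ} {Ω Ω' : Set (E n)}
    (hu : IsLocalMinimizer δ γ Ω u) (hΩ' : IsOpen Ω') (hsub : Ω' ⊆ Ω) {Du : E n → E n}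
    (hDu : HasH1Gradient Ω' u Du) (hδ : ∀ x ∈ Ω', 0 ≤ δ x)
    (hpot : IntegrableOn (fun x => δ x * (max (u x) 0) ^ (γ x)) Ω') {ζ : E n → ℝ} {Dζ : E n → E n}
    (hζ : HasH10Gradient Ω' ζ Dζ) {g : E n → ℝ} (hg : IntegrableOn g Ω') {t₀ : ℝ} (ht₀ : 0 < t₀)
    (h : ∀ t ∈ Ioo 0 t₀, ∀ᵐ x ∂(volume.restrict Ω'), δ x * (max (u x - t * ζ x) 0) ^ (γ x)
      ≤ δ x * (max (u x) 0) ^ (γ x) - t * g x) :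
    (∫ x in Ω', inner ℝ (Du x) (Dζ x)) + ∫ x in Ω', g x ≤ 0 := by
  set I := ∫ x in Ω', inner ℝ (Du x) (Dζ x) with hI
  set G := ∫ x in Ω', g x with hG
  set N := ∫ x in Ω', ‖Dζ x‖ ^ 2 with hN
  have hDζ := hζ.hasH1Gradient.memLp_grad
  have iN : Integrable (fun x => ‖Dζ x‖ ^ 2) (volume.restrict Ω') := hDζ.norm.integrable_sq
  have iD : Integrable (fun x => ‖Du x‖ ^ 2) (volume.restrict Ω') := hDu.memLp_grad.norm.integrable_sq
  have iI := integrable_inner_of_memLp hDu.memLp_grad hDζ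
  -- Expand the Dirichlet term of the competitor `u - t ζ`, cancel the energy of `u` and divide by
  -- `t`; only the quadratic term survives on the right.
  have key : ∀ t ∈ Ioo 0 t₀, I + G ≤ t * (N / 2) := by
    intro t ht
    have hv := hDu.add (hζ.const_mul (-t)).hasH1Gradient
    have hH10 : MemH10 Ω' (fun x => (u x + -t * ζ x) - u x) := by
      have : (fun x => (u x + -t * ζ x) - u x) = fun x => -t * ζ x := by
        ext x
        ring
      rw [this]
      exact ⟨_, (hζ.const_mul (-t)).hasH1Gradient, (hζ.const_mul (-t)).exists_approx⟩
    have hle := hu.energy_le Ω' hΩ' hsub _ _ _ hDu hv hH10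
    have iU : Integrable (fun x => (1 / 2) * ‖Du x‖ ^ 2 + δ x * (max (u x) 0) ^ (γ x))
        (volume.restrict Ω') := (iD.const_mul _).add hpot
    have iR : Integrable (fun x => -t * inner ℝ (Du x) (Dζ x) + (t ^ 2 / 2) * ‖Dζ x‖ ^ 2 + -t * g x)
        (volume.restrict Ω') := ((iI.const_mul _).add (iN.const_mul _)).add (hg.const_mul _)
    have hup : energy δ γ Ω' (fun x => u x + -t * ζ x) (fun x => Du x + -t • Dζ x)
        ≤ ∫ x in Ω', (((1 / 2) * ‖Du x‖ ^ 2 + δ x * (max (u x) 0) ^ (γ x))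
          + (-t * inner ℝ (Du x) (Dζ x) + (t ^ 2 / 2) * ‖Dζ x‖ ^ 2 + -t * g x)) := by
      -- Only the majorant has to be integrable, so nothing need be known about integrability of the
      -- competitor's potential term.
      refine integral_mono_of_nonneg ?_ (iU.add iR) ?_
      · filter_upwards [ae_restrict_mem hΩ'.measurableSet] with x hx
        have := hδ x hx
        positivity
      · filter_upwards [h t ht] with x hx
        have e1 : ‖Du x + -t • Dζ x‖ ^ 2
            = ‖Du x‖ ^ 2 - 2 * t * inner ℝ (Du x) (Dζ x) + t ^ 2 * ‖Dζ x‖ ^ 2 := by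
          rw [norm_add_sq_real, real_inner_smul_right, norm_smul, mul_pow, Real.norm_eq_abs, sq_abs]
          ring
        have e2 : u x + -t * ζ x = u x - t * ζ x := by ring
        simp only [e1, e2]
        linarith
    have h2 := hle.trans hup
    rw [integral_add iU iR, energy] at h2
    have e3 : ∫ x in Ω', (-t * inner ℝ (Du x) (Dζ x) + (t ^ 2 / 2) * ‖Dζ x‖ ^ 2 + -t * g x)
        = -t * I + (t ^ 2 / 2) * N + -t * G := by
      have i12 : Integrable (fun x => -t * inner ℝ (Du x) (Dζ x) + (t ^ 2 / 2) * ‖Dζ x‖ ^ 2)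
        (volume.restrict Ω') := (iI.const_mul _).add (iN.const_mul _)
      rw [integral_add i12 (hg.const_mul _),
        integral_add (iI.const_mul _) (iN.const_mul _), integral_const_mul, integral_const_mul,
        integral_const_mul]
    rw [e3] at h2
    have h3 : 0 ≤ t * (t * (N / 2) - (I + G)) := by linarith
    linarith [nonneg_of_mul_nonneg_right h3 ht.1]
  have hlim : Tendsto (fun t : ℝ => t * (N / 2)) (𝓝[>] 0) (𝓝 (0 * (N / 2))) :=
    (tendsto_id.mul_const _).mono_left nhdsWithin_le_nhds
  rw [zero_mul] at hlim
  refine ge_of_tendsto hlim ?_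
  filter_upwards [Ioo_mem_nhdsGT ht₀] with t ht using key t ht

theorem IsAdmissible.integrableOn_potential {δ γ u : E n → ℝ} (h : IsAdmissible δ γ)
    (hu : IsNormalizedMinimizer δ γ u) :
    IntegrableOn (fun x => δ x * (max (u x) 0) ^ (γ x)) (Metric.ball 0 1) := by
  obtain ⟨K, hK⟩ := h.bounded_delta
  obtain ⟨Du, hDu⟩ := hu.isLocalMinimizer.memH1
  refine Integrable.mono' (integrable_const K) ?_ ?_
  · exact (h.aemeasurable_delta.mul ((hDu.memLp.1.aemeasurable.max aemeasurable_const).pow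
      h.aemeasurable_gamma)).aestronglyMeasurable
  · filter_upwards [hu.le_one, ae_restrict_mem measurableSet_ball] with x h1 hx
    have hp : (max (u x) 0) ^ (γ x) ≤ 1 :=
      Real.rpow_le_one (le_max_right _ _) (max_le h1 zero_le_one) (h.nonneg_gamma x hx)
    have hp0 : 0 ≤ (max (u x) 0) ^ (γ x) := Real.rpow_nonneg (le_max_right _ _) _
    rw [Real.norm_of_nonneg (mul_nonneg (h.nonneg_delta x hx) hp0)]
    calc δ x * (max (u x) 0) ^ (γ x) ≤ δ x * 1 :=
          mul_le_mul_of_nonneg_left hp (h.nonneg_delta x hx)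
      _ ≤ K := by rw [mul_one]; exact hK x hx

/-- Minimizers are weakly subharmonic. -/
theorem IsNormalizedMinimizer.integral_inner_gradient_nonpos {δ γ u : E n → ℝ}
    (hu : IsNormalizedMinimizer δ γ u) (h : IsAdmissible δ γ) {Du : E n → E n}
    (hDu : HasH1Gradient (Metric.ball 0 1) u Du) {φ : E n → ℝ}
    (hφ : IsTestFunction (Metric.ball 0 1) φ) (hφ0 : ∀ x, 0 ≤ φ x) :
    ∫ x in Metric.ball 0 1, inner ℝ (Du x) (gradient φ x) ≤ 0 := by
  -- Here `g = 0` suffices: the potential is nondecreasing in `u`, so lowering `u` by a nonnegative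
  -- function does not raise it.
  have := hu.isLocalMinimizer.first_variation Metric.isOpen_ball le_rfl hDu h.nonneg_delta
    (h.integrableOn_potential hu) hφ.hasH10Gradient (g := fun _ => 0) integrableOn_zero
    (zero_lt_one) (fun t ht => ?_)
  · simpa using this
  · filter_upwards [ae_restrict_mem measurableSet_ball] with x hx
    rw [mul_zero, sub_zero]
    refine mul_le_mul_of_nonneg_left ?_ (h.nonneg_delta x hx)
    refine Real.rpow_le_rpow (le_max_right _ _) (max_le_max ?_ le_rfl) (h.nonneg_gamma x hx)
    linarith [mul_nonneg ht.1.le (hφ0 x)]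

/-! ### From weak subharmonicity to the sub-mean value inequality -/

/-- A smooth approximation of the positive part. -/
def smoothPosPart (c s : ℝ) : ℝ := ∫ τ in (0 : ℝ)..s, Real.smoothTransition (c * τ)

theorem hasDerivAt_smoothPosPart (c s : ℝ) :
    HasDerivAt (smoothPosPart c) (Real.smoothTransition (c * s)) s := by
  have hc : Continuous fun τ => Real.smoothTransition (c * τ) :=
    Real.smoothTransition.continuous.comp (continuous_const.mul continuous_id)
  exact (hc.integral_hasStrictDerivAt 0 s).hasDerivAt

theorem contDiff_smoothPosPart (c : ℝ) :
    ContDiff ℝ ((⊤ : ℕ∞) : WithTop ℕ∞) (smoothPosPart c) := by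
  rw [contDiff_infty_iff_deriv]
  refine ⟨fun s => (hasDerivAt_smoothPosPart c s).differentiableAt, ?_⟩
  have : deriv (smoothPosPart c) = fun s => Real.smoothTransition (c * s) :=
    funext fun s => (hasDerivAt_smoothPosPart c s).deriv
  rw [this]
  exact Real.smoothTransition.contDiff.comp (contDiff_const.mul contDiff_id)

theorem smoothPosPart_of_nonpos {c s : ℝ} (hc : 0 ≤ c) (hs : s ≤ 0) : smoothPosPart c s = 0 := by
  rw [smoothPosPart, intervalIntegral.integral_symm, neg_eq_zero]
  refine (intervalIntegral.integral_congr (g := fun _ => 0) fun τ hτ => ?_).trans (by simp)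
  rw [uIcc_of_le hs] at hτ
  exact Real.smoothTransition.zero_of_nonpos (mul_nonpos_of_nonneg_of_nonpos hc hτ.2)

theorem smoothPosPart_nonneg {c s : ℝ} (hc : 0 ≤ c) : 0 ≤ smoothPosPart c s := by
  rcases le_total s 0 with hs | hs
  · rw [smoothPosPart_of_nonpos hc hs]
  · exact intervalIntegral.integral_nonneg hs fun τ _ => Real.smoothTransition.nonneg _

theorem tendsto_smoothTransition_mul (s : ℝ) :
    Tendsto (fun j : ℕ => Real.smoothTransition (j * s)) atTop (𝓝 (if 0 < s then 1 else 0)) := by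
  split_ifs with hs
  · refine tendsto_const_nhds.congr' ?_
    have : Tendsto (fun j : ℕ => (j : ℝ) * s) atTop atTop :=
      tendsto_natCast_atTop_atTop.atTop_mul_const hs
    filter_upwards [this.eventually_ge_atTop 1] with j hj
    exact (Real.smoothTransition.one_of_one_le hj).symm
  · refine tendsto_const_nhds.congr fun j => ?_
    exact (Real.smoothTransition.zero_of_nonpos
      (mul_nonpos_of_nonneg_of_nonpos (Nat.cast_nonneg j) (not_lt.1 hs))).symm

theorem hasGradientAt_norm_sub_sq (x z : E n) :
    HasGradientAt (fun z => ‖z - x‖ ^ 2) ((2 : ℝ) • (z - x)) z := by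
  rw [hasGradientAt_iff_hasFDerivAt]
  have := ((hasFDerivAt_id z).sub_const x).norm_sq
  refine this.congr_fderiv ?_
  ext e
  simp

/-- Weak subharmonicity tested with `(t² - |z - x|²)⁺`, whose gradient is `-2 (z - x)` inside the
ball and zero outside. Smooth approximations of the positive part make it admissible, and dominated
convergence removes the smoothing. -/
theorem IsNormalizedMinimizer.setIntegral_inner_nonneg {δ γ u : E n → ℝ}
    (hu : IsNormalizedMinimizer δ γ u) (h : IsAdmissible δ γ) {Du : E n → E n}
    (hDu : HasH1Gradient (Metric.ball 0 1) u Du) {x : E n} {t : ℝ} (ht : 0 < t)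
    (hx : Metric.closedBall x t ⊆ Metric.ball 0 1) :
    0 ≤ ∫ z in Metric.ball x t, inner ℝ (Du z) (z - x) := by
  set B := Metric.ball (0 : E n) 1 with hB
  set s : E n → ℝ := fun z => t ^ 2 - ‖z - x‖ ^ 2 with hs
  have hspos : ∀ z, 0 < s z ↔ z ∈ Metric.ball x t := fun z => by
    rw [Metric.mem_ball, dist_eq_norm, hs, sub_pos, sq_lt_sq₀ (norm_nonneg _) ht.le]
  have hsm : ContDiff ℝ ((⊤ : ℕ∞) : WithTop ℕ∞) s :=
    contDiff_const.sub ((contDiff_id.sub contDiff_const).norm_sq ℝ)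
  have htest : ∀ j : ℕ, IsTestFunction B (fun z => smoothPosPart j (s z)) := by
    intro j
    have hts : tsupport (fun z => smoothPosPart j (s z)) ⊆ Metric.closedBall x t := by
      refine closure_minimal (fun z hz => ?_) Metric.isClosed_closedBall
      by_contra hz'
      refine hz (smoothPosPart_of_nonpos (Nat.cast_nonneg j) (not_lt.1 fun h0 => hz' ?_))
      exact Metric.ball_subset_closedBall ((hspos z).1 h0)
    exact ⟨(contDiff_smoothPosPart _).comp hsm, HasCompactSupport.of_support_subset_isCompact
      (isCompact_closedBall x t) ((subset_tsupport _).trans hts), hts.trans hx⟩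
  have hgrad : ∀ (j : ℕ) z, gradient (fun z => smoothPosPart j (s z)) z
      = (-2 * Real.smoothTransition (j * s z)) • (z - x) := by
    intro j z
    have h1 : HasFDerivAt s (-(InnerProductSpace.toDual ℝ (E n) ((2 : ℝ) • (z - x)))) z :=
      (hasGradientAt_norm_sub_sq x z).hasFDerivAt.const_sub _
    have h2 := (hasDerivAt_smoothPosPart j (s z)).comp_hasFDerivAt z h1
    have h3 : HasGradientAt (fun z => smoothPosPart j (s z))
        ((-2 * Real.smoothTransition (j * s z)) • (z - x)) z := by
      rw [hasGradientAt_iff_hasFDerivAt]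
      refine h2.congr_fderiv ?_
      ext e
      simp
      ring
    exact h3.gradient
  have hj : ∀ j : ℕ, 0 ≤ ∫ z in B, Real.smoothTransition (j * s z) * inner ℝ (Du z) (z - x) := by
    intro j
    have := hu.integral_inner_gradient_nonpos h hDu (htest j)
      fun z => smoothPosPart_nonneg (Nat.cast_nonneg j)
    simp_rw [hgrad, real_inner_smul_right, mul_assoc] at this
    rw [integral_const_mul] at this
    linarith
  have hzx : MemLp (fun z => z - x) 2 (volume.restrict B) := by
    refine MemLp.of_bound (C := 1 + ‖x‖) (by fun_prop) ?_
    filter_upwards [ae_restrict_mem measurableSet_ball] with z hz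
    refine (norm_sub_le _ _).trans ?_
    have : ‖z‖ < 1 := by simpa [hB] using hz
    linarith
  have hint := integrable_inner_of_memLp hDu.memLp_grad hzx
  have hlim : Tendsto (fun j : ℕ => ∫ z in B, Real.smoothTransition (j * s z) *
      inner ℝ (Du z) (z - x)) atTop (𝓝 (∫ z in B, (if 0 < s z then 1 else 0) *
      inner ℝ (Du z) (z - x))) := by
    refine tendsto_integral_of_dominated_convergence (fun z => ‖inner ℝ (Du z) (z - x)‖) ?_
      hint.norm ?_ ?_
    · intro j
      refine AEStronglyMeasurable.mul ?_ hint.1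
      exact (Real.smoothTransition.continuous.comp
        (continuous_const.mul hsm.continuous)).aestronglyMeasurable
    · refine fun j => Eventually.of_forall fun z => ?_
      rw [norm_mul, Real.norm_of_nonneg (Real.smoothTransition.nonneg _)]
      exact mul_le_of_le_one_left (norm_nonneg _) (Real.smoothTransition.le_one _)
    · exact Eventually.of_forall fun z => (tendsto_smoothTransition_mul (s z)).mul_const _
  have h0 := ge_of_tendsto' hlim hj
  have e : ∀ z, (if 0 < s z then (1 : ℝ) else 0) * inner ℝ (Du z) (z - x)
      = (Metric.ball x t).indicator (fun z => inner ℝ (Du z) (z - x)) z := by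
    intro z
    by_cases hz : z ∈ Metric.ball x t
    · rw [if_pos ((hspos z).2 hz), one_mul, indicator_of_mem hz]
    · rw [if_neg (fun h => hz ((hspos z).1 h)), zero_mul, indicator_of_notMem hz]
  simp_rw [e] at h0
  rwa [setIntegral_indicator measurableSet_ball, inter_eq_self_of_subset_right
    (Metric.ball_subset_closedBall.trans hx)] at h0

theorem setIntegral_ball_comp_sub (f : E n → ℝ) (x s : E n) (t : ℝ) :
    ∫ z in Metric.ball x t, f (z - s) = ∫ z in Metric.ball (x - s) t, f z := by
  rw [← integral_indicator measurableSet_ball, ← integral_indicator measurableSet_ball,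
    ← integral_sub_right_eq_self ((Metric.ball (x - s) t).indicator f) s]
  congr 1
  ext z
  have : z - s ∈ Metric.ball (x - s) t ↔ z ∈ Metric.ball x t := by
    rw [Metric.mem_ball, Metric.mem_ball, dist_sub_right]
  by_cases hz : z ∈ Metric.ball x t
  · rw [indicator_of_mem hz, indicator_of_mem (this.2 hz)]
  · rw [indicator_of_notMem hz, indicator_of_notMem fun h => hz (this.1 h)]

theorem setIntegral_ball_comp_smul (f : E n → ℝ) (x : E n) {t : ℝ} (ht : 0 < t) :
    ∫ z in Metric.ball 0 1, f (x + t • z) = (t ^ n)⁻¹ * ∫ z in Metric.ball x t, f z := by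
  have h1 := Measure.setIntegral_comp_smul_of_pos (volume : Measure (E n)) (fun w => f (x + w))
    (Metric.ball 0 1) ht
  rw [h1, smul_unitBall ht.ne', Real.norm_of_nonneg ht.le, finrank_euclideanSpace_fin, smul_eq_mul]
  have h2 := setIntegral_ball_comp_sub f 0 (-x) t
  rw [zero_sub, neg_neg] at h2
  rw [← h2]
  simp_rw [sub_neg_eq_add, add_comm]

theorem volume_real_ball (x : E n) {r : ℝ} (hr : 0 < r) :
    volume.real (Metric.ball x r) = r ^ n * volume.real (Metric.ball (0 : E n) 1) := by
  have := setIntegral_ball_comp_smul (fun _ => (1 : ℝ)) x hr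
  simp only [integral_const, MeasurableSet.univ, measureReal_restrict_apply, univ_inter,
    smul_eq_mul, mul_one] at this
  rw [this]
  field_simp

theorem memLp_indicator {F : Type*} [NormedAddCommGroup F] {Ω : Set (E n)} (hΩ : MeasurableSet Ω)
    {g : E n → F} (hg : MemLp g 2 (volume.restrict Ω)) : MemLp (Ω.indicator g) 2 volume :=
  (memLp_indicator_iff_restrict hΩ).2 hg

theorem integrable_indicator_of_memLp {F : Type*} [NormedAddCommGroup F] {Ω : Set (E n)}
    (hΩ : MeasurableSet Ω) (hfin : volume Ω ≠ ⊤)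
    {g : E n → F} (hg : MemLp g 2 (volume.restrict Ω)) : Integrable (Ω.indicator g) := by
  have : IsFiniteMeasure (volume.restrict Ω) :=
    ⟨by rw [Measure.restrict_apply_univ]; exact hfin.lt_top⟩
  exact (integrable_indicator_iff hΩ).2 (hg.integrable (by norm_num))

/-- By Fubini, the flux integral of the mollified field about `x` is a weighted average of flux
integrals of `D` about the nearby centres `x - s`. -/
theorem setIntegral_inner_mollify_nonneg {D : E n → E n} (hD : Integrable D) {k : ℕ} {x : E n}
    {t : ℝ} (h : ∀ s, ‖s‖ ≤ (bump n k).rOut →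
      0 ≤ ∫ z in Metric.ball (x - s) t, inner ℝ (D z) (z - (x - s))) :
    0 ≤ ∫ z in Metric.ball x t, inner ℝ (mollify k D z) (z - x) := by
  have hDl : LocallyIntegrable D := hD.locallyIntegrable
  have hconv : Integrable (fun p : E n × E n => kernel n k p.2 • D (p.1 - p.2))
      ((volume.restrict (Metric.ball x t)).prod volume) := by
    have h1 := (integrable_kernel (n := n) k).convolution_integrand
      (ContinuousLinearMap.lsmul ℝ ℝ) hD
    have h2 : (volume.restrict (Metric.ball x t)).prod (volume : Measure (E n))
        = (volume.prod volume).restrict (Metric.ball x t ×ˢ univ) := by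
      rw [← Measure.prod_restrict, Measure.restrict_univ]
    rw [h2]
    exact h1.integrableOn
  have hint : Integrable (Function.uncurry fun z s => kernel n k s * inner ℝ (D (z - s)) (z - x))
      ((volume.restrict (Metric.ball x t)).prod volume) := by
    have hm : AEStronglyMeasurable (fun p : E n × E n => p.1 - x)
      ((volume.restrict (Metric.ball x t)).prod volume) := by fun_prop
    refine Integrable.mono' (hconv.norm.mul_const t) ?_ ?_
    · refine (hconv.1.inner hm).congr (Eventually.of_forall fun p => ?_)
      simp [Function.uncurry, real_inner_smul_left]
    · have hae : ∀ᵐ p ∂((volume.restrict (Metric.ball x t)).prod (volume : Measure (E n))),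
          p.1 ∈ Metric.ball x t :=
        Measure.quasiMeasurePreserving_fst.ae (ae_restrict_mem measurableSet_ball)
      filter_upwards [hae] with p hp
      rw [Function.uncurry, ← real_inner_smul_left]
      refine (norm_inner_le_norm _ _).trans (mul_le_mul_of_nonneg_left ?_ (norm_nonneg _))
      rw [← dist_eq_norm]
      exact (Metric.mem_ball.1 hp).le
  have e1 : ∀ z, inner ℝ (mollify k D z) (z - x)
      = ∫ s, kernel n k s * inner ℝ (D (z - s)) (z - x) := by
    intro z
    rw [mollify_apply, real_inner_comm, ← integral_inner (integrable_kernel_smul hDl k z)]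
    congr 1
    ext s
    rw [real_inner_smul_right, real_inner_comm]
  simp_rw [e1]
  rw [integral_integral_swap hint]
  refine integral_nonneg fun s => ?_
  show 0 ≤ ∫ z in Metric.ball x t, kernel n k s * inner ℝ (D (z - s)) (z - x)
  rw [integral_const_mul]
  by_cases hs : ‖s‖ ≤ (bump n k).rOut
  · refine mul_nonneg (kernel_nonneg _ _) ?_
    have := setIntegral_ball_comp_sub (fun z => inner ℝ (D z) (z - (x - s))) x s t
    simp only [sub_sub_sub_cancel_right] at this
    rw [this]
    exact h s hs
  · rw [kernel_eq_zero (not_le.1 hs).le, zero_mul]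

/-- A `C¹` function satisfies the sub-mean value inequality if the flux-type integrals of its
gradient over concentric balls are nonnegative. -/
theorem mul_volume_le_setIntegral_ball {w : E n → ℝ} (hw : ContDiff ℝ 1 w) {x : E n} {T : ℝ}
    (hT : 0 < T)
    (h : ∀ t, 0 < t → t < T → 0 ≤ ∫ z in Metric.ball x t, fderiv ℝ w z (z - x)) :
    w x * volume.real (Metric.ball (0 : E n) 1) ≤ ∫ z in Metric.ball 0 1, w (x + T • z) := by
  set A : ℝ → ℝ := fun t => ∫ z in Metric.ball (0 : E n) 1, w (x + t • z) with hA
  have hdw : Continuous (fderiv ℝ w) := hw.continuous_fderiv (by norm_num)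
  obtain ⟨C, hC⟩ := (isCompact_closedBall x (T + 1)).exists_bound_of_continuousOn hdw.continuousOn
  obtain ⟨C', hC'⟩ := (isCompact_closedBall x (T + 1)).exists_bound_of_continuousOn
    hw.continuous.continuousOn
  -- An open interval containing `[0, T]`, so that `A` is differentiable, hence continuous, at both
  -- endpoints too.
  have hmem : ∀ t ∈ Ioo (-1) (T + 1), ∀ z ∈ Metric.ball (0 : E n) 1,
      x + t • z ∈ Metric.closedBall x (T + 1) := by
    intro t ht z hz
    rw [Metric.mem_closedBall, dist_eq_norm, add_sub_cancel_left, norm_smul, Real.norm_eq_abs]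
    have h1 : ‖z‖ < 1 := by simpa using hz
    have h2 : |t| ≤ T + 1 := abs_le.2 ⟨by linarith [ht.1], ht.2.le⟩
    nlinarith [norm_nonneg z, abs_nonneg t]
  have hder : ∀ t ∈ Ioo (-1) (T + 1),
      HasDerivAt A (∫ z in Metric.ball (0 : E n) 1, fderiv ℝ w (x + t • z) z) t := by
    intro t ht
    refine (hasDerivAt_integral_of_dominated_loc_of_deriv_le (bound := fun _ => C)
      (Ioo_mem_nhds ht.1 ht.2) (F := fun t z => w (x + t • z))
      (F' := fun t z => fderiv ℝ w (x + t • z) z)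
      ?_ ?_ ?_ ?_ (integrable_const _) ?_).2
    · refine Eventually.of_forall fun s => Continuous.aestronglyMeasurable ?_
      exact hw.continuous.comp (by fun_prop)
    · refine Integrable.mono' (integrable_const C') ?_ ?_
      · exact Continuous.aestronglyMeasurable (hw.continuous.comp (by fun_prop))
      · filter_upwards [ae_restrict_mem measurableSet_ball] with z hz using hC' _ (hmem t ht z hz)
    · refine Continuous.aestronglyMeasurable ?_
      exact (hdw.comp (by fun_prop)).clm_apply continuous_id
    · filter_upwards [ae_restrict_mem measurableSet_ball] with z hz s hs
      have h1 : ‖z‖ < 1 := by simpa using hz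
      have h2 := hC _ (hmem s hs z hz)
      calc _ ≤ ‖fderiv ℝ w (x + s • z)‖ * ‖z‖ := ContinuousLinearMap.le_opNorm _ _
        _ ≤ ‖fderiv ℝ w (x + s • z)‖ * 1 := mul_le_mul_of_nonneg_left h1.le (norm_nonneg _)
        _ ≤ C := by rwa [mul_one]
    · refine Eventually.of_forall fun z s _ => ?_
      have h1 : HasDerivAt (fun s : ℝ => x + s • z) z s := by
        simpa using ((hasDerivAt_id s).smul_const z).const_add x
      exact ((hw.differentiable (by norm_num) (x + s • z)).hasFDerivAt).comp_hasDerivAt s h1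
  -- Rescaling to `B_t(x)` shows that `A'(t)` equals `t^{-n-1}` times the flux integral in the
  -- hypothesis.
  have hmono : MonotoneOn A (Icc 0 T) := by
    refine monotoneOn_of_deriv_nonneg (convex_Icc _ _) ?_ ?_ ?_
    · intro t ht
      exact (hder t ⟨by linarith [ht.1], by linarith [ht.2]⟩).continuousAt.continuousWithinAt
    · intro t ht
      rw [interior_Icc] at ht
      exact (hder t ⟨by linarith [ht.1], by linarith [ht.2]⟩).differentiableAt.differentiableWithinAt
    · intro t ht
      rw [interior_Icc] at ht
      rw [(hder t ⟨by linarith [ht.1], by linarith [ht.2]⟩).deriv]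
      have h1 := setIntegral_ball_comp_smul (fun y => fderiv ℝ w y (t⁻¹ • (y - x))) x ht.1
      simp only [add_sub_cancel_left, smul_smul, inv_mul_cancel₀ ht.1.ne', one_smul] at h1
      rw [h1]
      simp_rw [map_smul, smul_eq_mul]
      rw [integral_const_mul]
      have := h t ht.1 ht.2
      have := ht.1
      positivity
  have h0 := hmono (left_mem_Icc.2 hT.le) (right_mem_Icc.2 hT.le) hT.le
  have e : A 0 = w x * volume.real (Metric.ball (0 : E n) 1) := by
    simp [hA, mul_comm]
  rwa [e] at h0

theorem closedBall_subset_unitBall {x : E n} {t : ℝ} (h : ‖x‖ + t < 1) :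
    Metric.closedBall x t ⊆ Metric.ball 0 1 := fun z hz => by
  rw [Metric.mem_closedBall, dist_eq_norm] at hz
  rw [Metric.mem_ball, dist_zero_right]
  calc ‖z‖ = ‖x + (z - x)‖ := by congr 1; abel
    _ ≤ ‖x‖ + ‖z - x‖ := norm_add_le _ _
    _ < 1 := by linarith

section
variable {δ γ u : E n → ℝ}

theorem IsNormalizedMinimizer.ae_indicator_mem (hu : IsNormalizedMinimizer δ γ u) :
    ∀ᵐ x, 0 ≤ (Metric.ball (0 : E n) 1).indicator u x ∧
      (Metric.ball (0 : E n) 1).indicator u x ≤ 1 := by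
  filter_upwards [(ae_restrict_iff' measurableSet_ball).1 hu.nonneg,
    (ae_restrict_iff' measurableSet_ball).1 hu.le_one] with x h0 h1
  by_cases hx : x ∈ Metric.ball (0 : E n) 1
  · rw [indicator_of_mem hx]
    exact ⟨h0 hx, h1 hx⟩
  · rw [indicator_of_notMem hx]
    exact ⟨le_rfl, zero_le_one⟩

/-- The mollifications are smooth and inherit the flux inequality, hence the sub-mean value
inequality. It passes to the limit at every point `x` where the mollifications converge. -/
theorem IsNormalizedMinimizer.ae_sub_mean_value (hu : IsNormalizedMinimizer δ γ u)
    (h : IsAdmissible δ γ) {T : ℝ} (hT : 0 < T) :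
    ∀ᵐ x : E n, ‖x‖ + T < 1 → u x * volume.real (Metric.ball x T) ≤ ∫ z in Metric.ball x T, u z := by
  set B := Metric.ball (0 : E n) 1 with hB
  have hBm : MeasurableSet B := measurableSet_ball
  have hBf : volume B ≠ ⊤ := measure_ball_lt_top.ne
  obtain ⟨Du, hDu⟩ := hu.isLocalMinimizer.memH1
  have iu := integrable_indicator_of_memLp hBm hBf hDu.memLp
  have iD := integrable_indicator_of_memLp hBm hBf hDu.memLp_grad
  have hlim := ae_tendsto_mollify iu.locallyIntegrable
  filter_upwards [hlim] with x hx hxT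
  have hstep : ∀ᶠ k in atTop, mollify k (B.indicator u) x * volume.real B
      ≤ ∫ z in B, mollify k (B.indicator u) (x + T • z) := by
    have hsmall : 0 < 1 - (‖x‖ + T) := by linarith
    filter_upwards [(tendsto_bump_rOut n).eventually (gt_mem_nhds hsmall)] with k hk
    refine mul_volume_le_setIntegral_ball ((contDiff_mollify iu.locallyIntegrable k).of_le
      (by exact_mod_cast le_top)) hT fun t ht htT => ?_
    have e : ∀ z ∈ Metric.ball x t, fderiv ℝ (mollify k (B.indicator u)) z (z - x)
        = inner ℝ (mollify k (B.indicator Du) z) (z - x) := by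
      intro z hz
      rw [Metric.mem_ball, dist_eq_norm] at hz
      have hz' : ‖z‖ ≤ ‖x‖ + ‖z - x‖ := by
        calc ‖z‖ = ‖x + (z - x)‖ := by congr 1; abel
          _ ≤ _ := norm_add_le _ _
      have hg := hasGradientAt_mollify hDu hBm
        (closedBall_subset_unitBall (x := z) (t := (bump n k).rOut) (by linarith))
      rw [← inner_gradient, hg.gradient]
    rw [setIntegral_congr_fun measurableSet_ball e]
    refine setIntegral_inner_mollify_nonneg iD fun s hs => ?_
    have hsx : ‖x - s‖ + t < 1 := by linarith [norm_sub_le x s]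
    have hsub := closedBall_subset_unitBall hsx
    have := hu.setIntegral_inner_nonneg h hDu ht hsub
    refine this.trans_eq (setIntegral_congr_fun measurableSet_ball fun z hz => ?_)
    rw [indicator_of_mem (hsub (Metric.ball_subset_closedBall hz))]
  have hlim2 : Tendsto (fun k => ∫ z in B, mollify k (B.indicator u) (x + T • z)) atTop
      (𝓝 (∫ z in B, B.indicator u (x + T • z))) := by
    refine tendsto_integral_of_dominated_convergence (fun _ => 1) ?_ (integrable_const _) ?_ ?_
    · intro k
      exact ((contDiff_mollify iu.locallyIntegrable k).continuous.comp
        (by fun_prop : Continuous fun z : E n => x + T • z)).aestronglyMeasurable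
    · refine fun k => Eventually.of_forall fun z => ?_
      rw [Real.norm_of_nonneg (mollify_nonneg (hu.ae_indicator_mem.mono fun _ h => h.1) _ _)]
      exact mollify_le iu.locallyIntegrable (hu.ae_indicator_mem.mono fun _ h _ => h.2)
    -- Affine dilations preserve null sets, so convergence at almost every point gives convergence
    -- at `x + T • z` for almost every `z`.
    · have hq : Measure.QuasiMeasurePreserving (fun z : E n => x + T • z) volume volume := by
        refine (measurePreserving_add_left volume x).quasiMeasurePreserving.comp
          ⟨measurable_const_smul T, ?_⟩
        rw [Measure.map_addHaar_smul _ hT.ne']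
        exact Measure.smul_absolutelyContinuous
      exact ae_restrict_of_ae (hq.ae hlim)
  have hxB : x ∈ B := by
    rw [hB, Metric.mem_ball, dist_zero_right]
    linarith
  have h1 := le_of_tendsto_of_tendsto (hx.mul_const _) hlim2 hstep
  rw [indicator_of_mem hxB, hB, setIntegral_ball_comp_smul _ x hT] at h1
  have hsub := Metric.ball_subset_closedBall.trans (closedBall_subset_unitBall hxT)
  have e1 : ∫ z in Metric.ball x T, (Metric.ball 0 1).indicator u z = ∫ z in Metric.ball x T, u z :=
    setIntegral_congr_fun measurableSet_ball fun z hz => indicator_of_mem (hsub hz) u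
  rw [e1] at h1
  rw [volume_real_ball x hT]
  have hTn : 0 < T ^ n := by positivity
  calc u x * (T ^ n * volume.real (Metric.ball (0 : E n) 1))
      = T ^ n * (u x * volume.real (Metric.ball (0 : E n) 1)) := by ring
    _ ≤ T ^ n * ((T ^ n)⁻¹ * ∫ z in Metric.ball x T, u z) := by gcongr
    _ = _ := by field_simp

end

/-! ### Upper semicontinuity of the precise representative -/

section
variable {δ γ u : E n → ℝ}

theorem IsNormalizedMinimizer.ae_restrict_ball_mem (hu : IsNormalizedMinimizer δ γ u) {x : E n}
    {r : ℝ} (h : ‖x‖ + r < 1) : ∀ᵐ z ∂(volume.restrict (Metric.ball x r)), 0 ≤ u z ∧ u z ≤ 1 :=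
  ae_restrict_of_ae_restrict_of_subset
    (Metric.ball_subset_closedBall.trans (closedBall_subset_unitBall h)) (hu.nonneg.and hu.le_one)

theorem IsNormalizedMinimizer.integrableOn_ball (hu : IsNormalizedMinimizer δ γ u) {x : E n}
    {r : ℝ} (h : ‖x‖ + r < 1) : IntegrableOn u (Metric.ball x r) := by
  obtain ⟨Du, hDu⟩ := hu.isLocalMinimizer.memH1
  have : IntegrableOn u (Metric.ball 0 1) := hDu.memLp.integrable (by norm_num)
  exact this.mono_set (Metric.ball_subset_closedBall.trans (closedBall_subset_unitBall h))

theorem volume_real_ball_pos (x : E n) {r : ℝ} (hr : 0 < r) :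
    0 < volume.real (Metric.ball x r) :=
  ENNReal.toReal_pos (Metric.measure_ball_pos _ _ hr).ne' measure_ball_lt_top.ne

theorem IsNormalizedMinimizer.average_le (hu : IsNormalizedMinimizer δ γ u) {x : E n} {r M : ℝ}
    (hr : 0 < r) (h : ‖x‖ + r < 1) (hM : ∀ᵐ z ∂(volume.restrict (Metric.ball x r)), u z ≤ M) :
    ⨍ z in Metric.ball x r, u z ≤ M := by
  have hv := volume_real_ball_pos x hr
  rw [setAverage_eq, smul_eq_mul, inv_mul_le_iff₀ hv]
  calc ∫ z in Metric.ball x r, u z ≤ ∫ z in Metric.ball x r, M :=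
        integral_mono_ae (hu.integrableOn_ball h) (integrable_const _) hM
    _ = _ := by simp

theorem IsNormalizedMinimizer.average_nonneg (hu : IsNormalizedMinimizer δ γ u) {x : E n} {r : ℝ}
    (h : ‖x‖ + r < 1) : 0 ≤ ⨍ z in Metric.ball x r, u z := by
  rw [setAverage_eq, smul_eq_mul]
  exact mul_nonneg (inv_nonneg.2 measureReal_nonneg)
    (integral_nonneg_of_ae ((hu.ae_restrict_ball_mem h).mono fun _ h => h.1))

theorem eventually_small_radius {x : E n} (hx : ‖x‖ < 1) :
    ∀ᶠ ρ : ℝ in 𝓝[>] 0, 0 < ρ ∧ ‖x‖ + ρ < 1 := by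
  filter_upwards [Ioo_mem_nhdsGT (sub_pos.2 hx)] with ρ hρ
  exact ⟨hρ.1, by linarith [hρ.2]⟩

theorem IsNormalizedMinimizer.isBoundedUnder_average (hu : IsNormalizedMinimizer δ γ u) {x : E n}
    (hx : ‖x‖ < 1) :
    IsBoundedUnder (· ≤ ·) (𝓝[>] 0) (fun ρ : ℝ => ⨍ z in Metric.ball x ρ, u z) :=
  ⟨1, by
    rw [eventually_map]
    filter_upwards [eventually_small_radius hx] with ρ hρ
    exact hu.average_le hρ.1 hρ.2 ((hu.ae_restrict_ball_mem hρ.2).mono fun _ h => h.2)⟩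

theorem IsNormalizedMinimizer.preciseRep_le (hu : IsNormalizedMinimizer δ γ u) {x : E n} {M : ℝ}
    (hx : ‖x‖ < 1) (h : ∀ᶠ ρ : ℝ in 𝓝[>] 0, ⨍ z in Metric.ball x ρ, u z ≤ M) :
    preciseRep u x ≤ M := by
  refine limsup_le_of_le ?_ h
  refine IsBoundedUnder.isCoboundedUnder_le ⟨0, ?_⟩
  rw [eventually_map]
  filter_upwards [eventually_small_radius hx] with ρ hρ using hu.average_nonneg hρ.2

theorem IsNormalizedMinimizer.preciseRep_le_one (hu : IsNormalizedMinimizer δ γ u) {x : E n}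
    (hx : ‖x‖ < 1) : preciseRep u x ≤ 1 := by
  refine hu.preciseRep_le hx ?_
  filter_upwards [eventually_small_radius hx] with ρ hρ
  exact hu.average_le hρ.1 hρ.2 ((hu.ae_restrict_ball_mem hρ.2).mono fun _ h => h.2)

theorem IsNormalizedMinimizer.preciseRep_nonneg (hu : IsNormalizedMinimizer δ γ u) {x : E n}
    (hx : ‖x‖ < 1) : 0 ≤ preciseRep u x := by
  refine le_limsup_of_frequently_le (Eventually.frequently ?_) (hu.isBoundedUnder_average hx)
  filter_upwards [eventually_small_radius hx] with ρ hρ using hu.average_nonneg hρ.2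

/-- Minimizers are upper semicontinuous: an upper bound for the precise representative at a point
is an almost everywhere bound in a neighbourhood. -/
theorem IsNormalizedMinimizer.exists_ae_le_of_preciseRep_lt (hu : IsNormalizedMinimizer δ γ u)
    (h : IsAdmissible δ γ) {x₀ : E n} (hx₀ : ‖x₀‖ < 1) {M : ℝ} (hM : preciseRep u x₀ < M) :
    ∃ η > 0, ∀ᵐ x, x ∈ Metric.ball x₀ η → u x ≤ M := by
  obtain ⟨M', hM', hM'M⟩ := exists_between hM
  have hev := (eventually_lt_of_limsup_lt hM' (hu.isBoundedUnder_average hx₀)).and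
    (eventually_small_radius hx₀)
  obtain ⟨ρ, hρ, hρs⟩ := (mem_nhdsGT_iff_exists_Ioo_subset).1 hev
  set T := ρ / 2 with hT
  have hρ0 : 0 < ρ := hρ
  have hT0 : 0 < T := by positivity
  -- For `x` within `η` of `x₀`, the ball `B_T(x)` lies in `B_{T+η}(x₀)`, where the average is below
  -- `M'`. Since `u ≥ 0`, enlarging the ball costs only the volume ratio, which tends to `1` as `η →
  -- 0`.
  have hcont : Tendsto (fun η : ℝ => M' * ((T + η) / T) ^ n) (𝓝[>] 0)
      (𝓝 (M' * ((T + 0) / T) ^ n)) := by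
    have : Continuous fun η : ℝ => M' * ((T + η) / T) ^ n := by fun_prop
    exact (this.tendsto 0).mono_left nhdsWithin_le_nhds
  rw [add_zero, div_self hT0.ne', one_pow, mul_one] at hcont
  obtain ⟨η, hη1, hη0, hη2⟩ := ((hcont.eventually (gt_mem_nhds hM'M)).and
    (Ioo_mem_nhdsGT hT0)).exists
  have hmem : T + η ∈ Ioo 0 ρ := ⟨by positivity, by linarith⟩
  obtain ⟨havg, -, hnorm⟩ := hρs hmem
  refine ⟨η, hη0, ?_⟩
  filter_upwards [hu.ae_sub_mean_value h hT0] with x hx hxη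
  rw [Metric.mem_ball] at hxη
  have hxn : ‖x‖ ≤ ‖x₀‖ + dist x x₀ := by
    rw [dist_eq_norm]
    calc ‖x‖ = ‖x₀ + (x - x₀)‖ := by congr 1; abel
      _ ≤ _ := norm_add_le _ _
  have h1 := hx (by linarith)
  have hsub : Metric.ball x T ⊆ Metric.ball x₀ (T + η) :=
    Metric.ball_subset_ball' (by linarith)
  have h2 : ∫ z in Metric.ball x T, u z ≤ ∫ z in Metric.ball x₀ (T + η), u z :=
    setIntegral_mono_set (hu.integrableOn_ball hnorm)
      ((hu.ae_restrict_ball_mem hnorm).mono fun _ h => h.1) hsub.eventuallyLE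
  have hTη : 0 < T + η := by positivity
  rw [setAverage_eq, smul_eq_mul, inv_mul_lt_iff₀ (volume_real_ball_pos _ hTη),
    volume_real_ball _ hTη] at havg
  rw [volume_real_ball _ hT0] at h1
  have hv := volume_real_ball_pos (0 : E n) one_pos
  have hTn : 0 < T ^ n := by positivity
  have h3 : u x * (T ^ n * volume.real (Metric.ball (0 : E n) 1))
      ≤ M * (T ^ n * volume.real (Metric.ball (0 : E n) 1)) := by
    calc _ ≤ (T + η) ^ n * volume.real (Metric.ball (0 : E n) 1) * M' := h1.trans (h2.trans havg.le)
      _ = M' * ((T + η) / T) ^ n * (T ^ n * volume.real (Metric.ball (0 : E n) 1)) := by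
        rw [div_pow]
        field_simp
      _ ≤ _ := by gcongr
  exact le_of_mul_le_mul_right h3 (by positivity)

theorem IsNormalizedMinimizer.preciseRep_le_supSphere (hu : IsNormalizedMinimizer δ γ u) {y : E n}
    {r : ℝ} (hr : ‖y‖ + r < 1) {x : E n} (hx : x ∈ Metric.sphere y r) :
    preciseRep u x ≤ supSphere u y r := by
  refine le_csSup ⟨1, ?_⟩ (mem_image_of_mem _ hx)
  rintro _ ⟨z, hz, rfl⟩
  have := closedBall_subset_unitBall hr (Metric.sphere_subset_closedBall hz)
  exact hu.preciseRep_le_one (by simpa using this)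

/-- A bound for the supremum over a sphere is an almost everywhere bound in an annulus. -/
theorem IsNormalizedMinimizer.exists_ae_le_of_supSphere_lt (hu : IsNormalizedMinimizer δ γ u)
    (h : IsAdmissible δ γ) {y : E n} {r : ℝ} (hr0 : 0 < r) (hr : ‖y‖ + r < 1) {M : ℝ}
    (hM : supSphere u y r < M) :
    ∃ η ∈ Ioo 0 r, ∀ᵐ x, r - η < dist x y → dist x y < r + η → u x ≤ M := by
  have hcover : ∃ U, IsOpen U ∧ Metric.sphere y r ⊆ U ∧ ∀ᵐ x, x ∈ U → u x ≤ M := by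
    refine (isCompact_sphere y r).induction_on
      (p := fun s => ∃ U, IsOpen U ∧ s ⊆ U ∧ ∀ᵐ x, x ∈ U → u x ≤ M) ?_ ?_ ?_ ?_
    · exact ⟨∅, isOpen_empty, le_rfl, by simp⟩
    · rintro s t hst ⟨U, hU, htU, hae⟩
      exact ⟨U, hU, hst.trans htU, hae⟩
    · rintro s t ⟨U, hU, hsU, haeU⟩ ⟨V, hV, htV, haeV⟩
      refine ⟨U ∪ V, hU.union hV, union_subset_union hsU htV, ?_⟩
      filter_upwards [haeU, haeV] with x hx1 hx2 hx
      exact hx.elim hx1 hx2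
    · intro x hx
      have hxn := closedBall_subset_unitBall hr (Metric.sphere_subset_closedBall hx)
      obtain ⟨η, hη, hae⟩ := hu.exists_ae_le_of_preciseRep_lt h (x₀ := x) (by simpa using hxn)
        ((hu.preciseRep_le_supSphere hr hx).trans_lt hM)
      exact ⟨Metric.ball x η, mem_nhdsWithin_of_mem_nhds (Metric.ball_mem_nhds x hη),
        Metric.ball x η, Metric.isOpen_ball, le_rfl, hae⟩
  obtain ⟨U, hU, hsU, hae⟩ := hcover
  obtain ⟨η, hη, hηU⟩ := (isCompact_sphere y r).exists_thickening_subset_open hU hsU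
  refine ⟨min η (r / 2), ⟨by positivity, (min_le_right _ _).trans_lt (by linarith)⟩, ?_⟩
  filter_upwards [hae] with x hx h1 h2
  refine hx (hηU ?_)
  have hη1 := min_le_left η (r / 2)
  have hη2 := min_le_right η (r / 2)
  set d := dist x y with hd
  have hd0 : 0 < d := by linarith
  rw [Metric.mem_thickening_iff]
  -- The radial projection of `x` to the sphere, at distance `|d - r|`. Taking `η ≤ r / 2` keeps `x`
  -- away from the centre.
  refine ⟨y + (r / d) • (x - y), ?_, ?_⟩
  · rw [mem_sphere_iff_norm, add_sub_cancel_left, norm_smul, ← dist_eq_norm, ← hd,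
      Real.norm_of_nonneg (by positivity)]
    field_simp
  · have e : x - (y + (r / d) • (x - y)) = (1 - r / d) • (x - y) := by
      rw [sub_smul, one_smul]
      abel
    have e2 : |1 - r / d| * d = |d - r| := by
      calc |1 - r / d| * d = |1 - r / d| * |d| := by rw [abs_of_pos hd0]
        _ = _ := by rw [← abs_mul, sub_mul, one_mul, div_mul_cancel₀ _ hd0.ne']
    rw [dist_eq_norm, e, norm_smul, Real.norm_eq_abs, ← dist_eq_norm x y, ← hd, e2, abs_lt]
    exact ⟨by linarith, by linarith⟩

end

/-! ### Chain rule for `G(u, ·)` and membership in `H¹₀` -/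

/-- Dominated convergence in `L²`. -/
theorem tendsto_eLpNorm_two_of_dominated {α F : Type*} [MeasurableSpace α] {μ : Measure α}
    [NormedAddCommGroup F] {f : α → F} {fk : ℕ → α → F} {h : α → ℝ}
    (hf : AEStronglyMeasurable f μ) (hfk : ∀ k, AEStronglyMeasurable (fk k) μ) (hh : MemLp h 2 μ)
    (hb : ∀ k, ∀ᵐ x ∂μ, ‖f x - fk k x‖ ≤ h x)
    (hlim : ∀ᵐ x ∂μ, Tendsto (fun k => fk k x) atTop (𝓝 (f x))) :
    Tendsto (fun k => eLpNorm (fun x => f x - fk k x) 2 μ) atTop (𝓝 0) := by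
  simp_rw [eLpNorm_two_eq_lintegral]
  have h1 : Tendsto (fun k => ∫⁻ x, ‖f x - fk k x‖ₑ ^ (2 : ℝ) ∂μ) atTop (𝓝 (∫⁻ _, 0 ∂μ)) := by
    refine tendsto_lintegral_of_dominated_convergence' (fun x => ‖h x‖ₑ ^ (2 : ℝ)) ?_ ?_ ?_ ?_
    · exact fun k => (hf.sub (hfk k)).enorm.pow_const _
    · intro k
      filter_upwards [hb k] with x hx
      refine ENNReal.rpow_le_rpow ?_ (by norm_num)
      rw [← ofReal_norm, ← ofReal_norm]
      exact ENNReal.ofReal_le_ofReal (hx.trans (le_abs_self _))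
    · intro htop
      have h2 := hh.2
      rw [eLpNorm_two_eq_lintegral, htop, ENNReal.top_rpow_of_pos (by norm_num)] at h2
      exact lt_irrefl _ h2
    · filter_upwards [hlim] with x hx
      have h3 : Tendsto (fun k => ‖f x - fk k x‖ₑ) atTop (𝓝 ‖f x - f x‖ₑ) :=
        (continuous_enorm.tendsto _).comp (tendsto_const_nhds.sub hx)
      rw [sub_self, enorm_zero] at h3
      have h4 := ((ENNReal.continuous_rpow_const (y := 2)).tendsto 0).comp h3
      rwa [ENNReal.zero_rpow_of_pos (by norm_num)] at h4
  rw [lintegral_zero] at h1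
  have h5 := ((ENNReal.continuous_rpow_const (y := 1 / 2)).tendsto 0).comp h1
  rwa [ENNReal.zero_rpow_of_pos (by norm_num)] at h5

/-- The data of a smooth function `G(s, x)`, `s ≥ 0`, with its partial gradients `Gs`, `Gx`. -/
structure IsChainFunction (G Gs : ℝ → E n → ℝ) (Gx : ℝ → E n → E n) : Prop where
  contDiff : ∀ w : E n → ℝ, ContDiff ℝ ((⊤ : ℕ∞) : WithTop ℕ∞) w → (∀ x, 0 ≤ w x) →
    ContDiff ℝ ((⊤ : ℕ∞) : WithTop ℕ∞) (fun x => G (w x) x)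
  hasGradientAt : ∀ (w : E n → ℝ) (g x : E n), HasGradientAt w g x → 0 ≤ w x →
    HasGradientAt (fun x => G (w x) x) (Gs (w x) x • g + Gx (w x) x) x
  continuousOn : ContinuousOn (Function.uncurry G) (Icc 0 1 ×ˢ univ)
  continuousOn_fst : ContinuousOn (Function.uncurry Gs) (Icc 0 1 ×ˢ univ)
  continuousOn_snd : ContinuousOn (Function.uncurry Gx) (Icc 0 1 ×ˢ univ)

theorem tendsto_comp_of_continuousOn {F : Type*} [TopologicalSpace F] {H : ℝ → E n → F}
    (hH : ContinuousOn (Function.uncurry H) (Icc 0 1 ×ˢ univ)) {s : ℕ → ℝ} {a : ℝ} {x : E n}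
    (hs : ∀ k, s k ∈ Icc (0 : ℝ) 1) (ha : a ∈ Icc (0 : ℝ) 1) (h : Tendsto s atTop (𝓝 a)) :
    Tendsto (fun k => H (s k) x) atTop (𝓝 (H a x)) := by
  have h1 := hH (a, x) ⟨ha, mem_univ _⟩
  have h2 : Tendsto (fun k => (s k, x)) atTop (𝓝[Icc 0 1 ×ˢ univ] (a, x)) :=
    tendsto_nhdsWithin_iff.2 ⟨h.prodMk_nhds tendsto_const_nhds,
      Eventually.of_forall fun k => ⟨hs k, mem_univ _⟩⟩
  exact h1.tendsto.comp h2

theorem exists_bound_of_continuousOn {F : Type*} [NormedAddCommGroup F] {H : ℝ → E n → F}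
    (hH : ContinuousOn (Function.uncurry H) (Icc 0 1 ×ˢ univ)) (y : E n) (r : ℝ) :
    ∃ C, 0 ≤ C ∧ ∀ s ∈ Icc (0 : ℝ) 1, ∀ x ∈ Metric.ball y r, ‖H s x‖ ≤ C := by
  obtain ⟨C, hC⟩ := (isCompact_Icc.prod (isCompact_closedBall y r)).exists_bound_of_continuousOn
    (hH.mono (prod_mono_right (subset_univ _)) :
      ContinuousOn (Function.uncurry H) (Icc (0 : ℝ) 1 ×ˢ Metric.closedBall y r))
  refine ⟨max C 0, le_max_right _ _, fun s hs x hx => ?_⟩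
  exact (hC (s, x) ⟨hs, Metric.ball_subset_closedBall hx⟩).trans (le_max_left _ _)

/-- A function that is smooth in a ball and vanishes near its boundary is a test function. -/
theorem isTestFunction_indicator_ball {f : E n → ℝ}
    (hf : ContDiff ℝ ((⊤ : ℕ∞) : WithTop ℕ∞) f) {y : E n} {r r' : ℝ} (hr : r' < r)
    (h0 : ∀ x, r' < dist x y → dist x y < r → f x = 0) :
    IsTestFunction (Metric.ball y r) ((Metric.ball y r).indicator f) := by
  have hzero : ∀ x, r' < dist x y → (Metric.ball y r).indicator f x = 0 := by
    intro x hx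
    by_cases hxr : x ∈ Metric.ball y r
    · rw [indicator_of_mem hxr]
      exact h0 x hx hxr
    · exact indicator_of_notMem hxr _
  have hts : tsupport ((Metric.ball y r).indicator f) ⊆ Metric.closedBall y r' := by
    refine closure_minimal (fun x hx => ?_) Metric.isClosed_closedBall
    by_contra hx'
    exact hx (hzero x (not_le.1 hx'))
  refine ⟨?_, HasCompactSupport.of_support_subset_isCompact (isCompact_closedBall y r')
    ((subset_tsupport _).trans hts), hts.trans (Metric.closedBall_subset_ball hr)⟩
  rw [contDiff_iff_contDiffAt]
  intro x
  by_cases hx : x ∈ Metric.ball y r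
  · refine hf.contDiffAt.congr_of_eventuallyEq ?_
    filter_upwards [Metric.isOpen_ball.mem_nhds hx] with z hz using indicator_of_mem hz f
  · have hx' : x ∈ (Metric.closedBall y r')ᶜ := fun h =>
      hx (Metric.closedBall_subset_ball hr h)
    refine (contDiffAt_const (c := (0 : ℝ))).congr_of_eventuallyEq ?_
    filter_upwards [Metric.isClosed_closedBall.isOpen_compl.mem_nhds hx'] with z hz
    exact hzero z (not_le.1 hz)

/-- Chain rule: `G(u, ·)` belongs to `H¹₀` of a ball if it vanishes for the values that `u` takes
near the boundary. -/
theorem IsChainFunction.hasH10Gradient {G Gs : ℝ → E n → ℝ} {Gx : ℝ → E n → E n}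
    (hG : IsChainFunction G Gs Gx) {u : E n → ℝ} {Du : E n → E n}
    (hDu : HasH1Gradient (Metric.ball 0 1) u Du)
    (hu : ∀ᵐ x, 0 ≤ (Metric.ball (0 : E n) 1).indicator u x ∧
      (Metric.ball (0 : E n) 1).indicator u x ≤ 1)
    {y : E n} {r η M : ℝ} (hr : ‖y‖ + r < 1) (hη : 0 < η) (hM0 : 0 ≤ M)
    (hM : ∀ᵐ x, r - η < dist x y → dist x y < r + η → u x ≤ M)
    (hG0 : ∀ s x, 0 ≤ s → s ≤ M → r - η < dist x y → dist x y < r → G s x = 0) :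
    HasH10Gradient (Metric.ball y r) (fun x => G (u x) x)
      (fun x => Gs (u x) x • Du x + Gx (u x) x) := by
  set B₁ := Metric.ball (0 : E n) 1 with hB₁
  set B := Metric.ball y r with hB
  have hB₁m : MeasurableSet B₁ := measurableSet_ball
  have hBsub : B ⊆ B₁ := Metric.ball_subset_closedBall.trans (closedBall_subset_unitBall hr)
  have iu := (memLp_indicator hB₁m hDu.memLp).locallyIntegrable (by norm_num)
  have mD := memLp_indicator hB₁m hDu.memLp_grad
  have iD := mD.locallyIntegrable (by norm_num)
  -- Start the mollifications so late that the radius is below `η / 2`, which keeps the bound `M` in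
  -- a thinner annulus, and below the distance from `B_r(y)` to the unit sphere, which makes their
  -- gradients mollified weak gradients.
  obtain ⟨N, hN⟩ := eventually_atTop.1 ((tendsto_bump_rOut n).eventually
    (gt_mem_nhds (lt_min (half_pos hη) (sub_pos.2 hr))))
  set uk : ℕ → E n → ℝ := fun k => mollify (k + N) (B₁.indicator u) with huk
  set Dk : ℕ → E n → E n := fun k => mollify (k + N) (B₁.indicator Du) with hDk
  have hk : ∀ k, (bump n (k + N)).rOut < η / 2 ∧ (bump n (k + N)).rOut < 1 - (‖y‖ + r) :=
    fun k => lt_min_iff.1 (hN (k + N) (Nat.le_add_left _ _))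
  have huk01 : ∀ k x, uk k x ∈ Icc (0 : ℝ) 1 := fun k x =>
    ⟨mollify_nonneg (hu.mono fun _ h => h.1) _ _, mollify_le iu (hu.mono fun _ h _ => h.2)⟩
  have huksm : ∀ k, ContDiff ℝ ((⊤ : ℕ∞) : WithTop ℕ∞) (uk k) := fun k => contDiff_mollify iu _
  have hukM : ∀ k x, r - η / 2 < dist x y → dist x y < r → uk k x ≤ M := by
    intro k x h1 h2
    refine mollify_le iu ?_
    filter_upwards [hM] with z hz hzx
    by_cases hz1 : z ∈ B₁
    · rw [indicator_of_mem hz1]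
      have h3 := (Metric.mem_ball.1 hzx).trans (hk k).1
      have h4 := dist_triangle z x y
      have h5 := dist_triangle_left x y z
      exact hz (by linarith) (by linarith)
    · rwa [indicator_of_notMem hz1]
  set φ : ℕ → E n → ℝ := fun k => B.indicator fun x => G (uk k x) x with hφ
  have hφtest : ∀ k, IsTestFunction B (φ k) := by
    intro k
    refine isTestFunction_indicator_ball (hG.contDiff _ (huksm k) fun x => (huk01 k x).1)
      (r' := r - η / 2) (by linarith) fun x h1 h2 => ?_
    exact hG0 _ x (huk01 k x).1 (hukM k x h1 h2) (by linarith) h2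
  have hukgrad : ∀ k, ∀ x ∈ B, HasGradientAt (uk k) (Dk k x) x := by
    intro k x hx
    refine hasGradientAt_mollify hDu hB₁m (closedBall_subset_unitBall ?_)
    have h1 : ‖x‖ ≤ ‖y‖ + dist x y := by
      rw [dist_eq_norm]
      calc ‖x‖ = ‖y + (x - y)‖ := by congr 1; abel
        _ ≤ _ := norm_add_le _ _
    linarith [(hk k).2, Metric.mem_ball.1 hx]
  have hφgrad : ∀ k, ∀ x ∈ B, gradient (φ k) x = Gs (uk k x) x • Dk k x + Gx (uk k x) x := by
    intro k x hx
    have h1 := hG.hasGradientAt (uk k) (Dk k x) x (hukgrad k x hx) (huk01 k x).1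
    have h2 : φ k =ᶠ[𝓝 x] fun x => G (uk k x) x := by
      filter_upwards [Metric.isOpen_ball.mem_nhds hx] with z hz using indicator_of_mem hz _
    exact (h1.congr_of_eventuallyEq h2).gradient
  have hmB : MeasurableSet B := measurableSet_ball
  have huB : ∀ᵐ x ∂(volume.restrict B), u x ∈ Icc (0 : ℝ) 1 := by
    filter_upwards [ae_restrict_of_ae hu, ae_restrict_mem hmB] with x hx hxB
    rwa [indicator_of_mem (hBsub hxB)] at hx
  have hukt : ∀ᵐ x ∂(volume.restrict B), Tendsto (fun k => uk k x) atTop (𝓝 (u x)) := by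
    filter_upwards [ae_restrict_of_ae (ae_tendsto_mollify iu), ae_restrict_mem hmB] with x hx hxB
    rw [indicator_of_mem (hBsub hxB)] at hx
    exact hx.comp (tendsto_add_atTop_nat N)
  have hDkL2 : Tendsto (fun k => eLpNorm (fun x => Du x - Dk k x) 2 (volume.restrict B)) atTop
      (𝓝 0) := by
    have h1 := (tendsto_eLpNorm_mollify_sub mD).comp (tendsto_add_atTop_nat N)
    refine tendsto_of_tendsto_of_tendsto_of_le_of_le tendsto_const_nhds h1 (fun _ => zero_le) ?_
    intro k
    refine le_trans (le_of_eq ?_) (eLpNorm_mono_measure _ (Measure.restrict_le_self (s := B)))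
    refine eLpNorm_congr_norm_ae ?_
    filter_upwards [ae_restrict_mem hmB] with x hx
    rw [Pi.sub_apply, indicator_of_mem (hBsub hx), norm_sub_rev]
  obtain ⟨C, hC0, hC⟩ := exists_bound_of_continuousOn hG.continuousOn y r
  obtain ⟨Cs, hCs0, hCs⟩ := exists_bound_of_continuousOn hG.continuousOn_fst y r
  obtain ⟨Cx, hCx0, hCx⟩ := exists_bound_of_continuousOn hG.continuousOn_snd y r
  have hcomp : ∀ {F : Type} [NormedAddCommGroup F] {H : ℝ → E n → F},
      ContinuousOn (Function.uncurry H) (Icc 0 1 ×ˢ univ) → ∀ k,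
      Continuous fun x => H (uk k x) x := by
    intro F _ H hH k
    exact hH.comp_continuous (f := fun x => (uk k x, x))
      ((huksm k).continuous.prodMk continuous_id) fun x => ⟨huk01 k x, mem_univ _⟩
  have hmeas : ∀ {F : Type} [NormedAddCommGroup F] {H : ℝ → E n → F},
      ContinuousOn (Function.uncurry H) (Icc 0 1 ×ˢ univ) →
      AEStronglyMeasurable (fun x => H (u x) x) (volume.restrict B) := by
    intro F _ H hH
    refine aestronglyMeasurable_of_tendsto_ae atTop (f := fun k x => H (uk k x) x)
      (fun k => (hcomp hH k).aestronglyMeasurable) ?_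
    filter_upwards [hukt, huB] with x hx hxu
    exact tendsto_comp_of_continuousOn hH (fun k => huk01 k x) hxu hx
  have mDu : MemLp Du 2 (volume.restrict B) :=
    hDu.memLp_grad.mono_measure (Measure.restrict_mono hBsub le_rfl)
  have mG : MemLp (fun x => G (u x) x) 2 (volume.restrict B) := by
    refine MemLp.of_bound (hmeas hG.continuousOn) C ?_
    filter_upwards [huB, ae_restrict_mem hmB] with x hx hxB using hC _ hx x hxB
  have mGs : MemLp (fun x => Gs (u x) x • Du x) 2 (volume.restrict B) := by
    refine MemLp.of_le_mul (c := Cs) mDu ((hmeas hG.continuousOn_fst).smul mDu.1) ?_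
    filter_upwards [huB, ae_restrict_mem hmB] with x hx hxB
    rw [norm_smul]
    exact mul_le_mul_of_nonneg_right (hCs _ hx x hxB) (norm_nonneg _)
  have mGx : MemLp (fun x => Gx (u x) x) 2 (volume.restrict B) := by
    refine MemLp.of_bound (hmeas hG.continuousOn_snd) Cx ?_
    filter_upwards [huB, ae_restrict_mem hmB] with x hx hxB using hCx _ hx x hxB
  have t1 : Tendsto (fun k => eLpNorm (fun x => G (u x) x - φ k x) 2 (volume.restrict B)) atTop
      (𝓝 0) := by
    refine tendsto_eLpNorm_two_of_dominated (h := fun _ => 2 * C) mG.1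
      (fun k => ((hφtest k).memLp _).1) (memLp_const _) ?_ ?_
    · intro k
      filter_upwards [huB, ae_restrict_mem hmB] with x hx hxB
      have e : φ k x = G (uk k x) x := indicator_of_mem hxB _
      rw [e]
      linarith [norm_sub_le (G (u x) x) (G (uk k x) x), hC _ hx x hxB, hC _ (huk01 k x) x hxB]
    · filter_upwards [huB, ae_restrict_mem hmB, hukt] with x hx hxB hxt
      have e : ∀ k, φ k x = G (uk k x) x := fun k => indicator_of_mem hxB _
      simp_rw [e]
      exact tendsto_comp_of_continuousOn hG.continuousOn (fun k => huk01 k x) hx hxt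
  have t2 : Tendsto (fun k => eLpNorm (fun x => (Gs (u x) x • Du x + Gx (u x) x)
      - gradient (φ k) x) 2 (volume.restrict B)) atTop (𝓝 0) := by
    -- Split the error in two: replacing `u` by `uk` in the coefficients with `Du` fixed is
    -- dominated by a multiple of `‖Du‖` plus a constant, while replacing `Du` by `Dk` is controlled
    -- by the sup of `Gs` and `L²` convergence.
    have t3 : Tendsto (fun k => eLpNorm (fun x => (Gs (u x) x • Du x + Gx (u x) x)
        - (Gs (uk k x) x • Du x + Gx (uk k x) x)) 2 (volume.restrict B)) atTop (𝓝 0) := by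
      refine tendsto_eLpNorm_two_of_dominated (h := fun x => 2 * (Cs * ‖Du x‖ + Cx))
        (mGs.1.add mGx.1) ?_ (((mDu.norm.const_mul Cs).add (memLp_const Cx)).const_mul 2) ?_ ?_
      · intro k
        exact ((hcomp hG.continuousOn_fst k).aestronglyMeasurable.smul mDu.1).add
          (hcomp hG.continuousOn_snd k).aestronglyMeasurable
      · intro k
        filter_upwards [huB, ae_restrict_mem hmB] with x hx hxB
        have hb : ∀ s ∈ Icc (0 : ℝ) 1, ‖Gs s x • Du x + Gx s x‖ ≤ Cs * ‖Du x‖ + Cx := by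
          intro s hs
          refine (norm_add_le _ _).trans (add_le_add ?_ (hCx s hs x hxB))
          rw [norm_smul]
          exact mul_le_mul_of_nonneg_right (hCs s hs x hxB) (norm_nonneg _)
        linarith [norm_sub_le (Gs (u x) x • Du x + Gx (u x) x)
          (Gs (uk k x) x • Du x + Gx (uk k x) x), hb _ hx, hb _ (huk01 k x)]
      · filter_upwards [huB, ae_restrict_mem hmB, hukt] with x hx hxB hxt
        exact ((tendsto_comp_of_continuousOn hG.continuousOn_fst (fun k => huk01 k x) hx
          hxt).smul_const _).add
          (tendsto_comp_of_continuousOn hG.continuousOn_snd (fun k => huk01 k x) hx hxt)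
    have t4 := ENNReal.Tendsto.const_mul (a := ENNReal.ofReal Cs) hDkL2
      (Or.inr ENNReal.ofReal_ne_top)
    rw [mul_zero] at t4
    have t5 := t3.add t4
    rw [add_zero] at t5
    refine tendsto_of_tendsto_of_tendsto_of_le_of_le tendsto_const_nhds t5 (fun _ => zero_le) ?_
    intro k
    have mDk : AEStronglyMeasurable (Dk k) (volume.restrict B) :=
      (contDiff_mollify iD _).continuous.aestronglyMeasurable
    have mGsk := (hcomp hG.continuousOn_fst k).aestronglyMeasurable (μ := volume.restrict B)
    have mGxk := (hcomp hG.continuousOn_snd k).aestronglyMeasurable (μ := volume.restrict B)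
    have e : (fun x => (Gs (u x) x • Du x + Gx (u x) x) - gradient (φ k) x)
        =ᵐ[volume.restrict B] (fun x => (Gs (u x) x • Du x + Gx (u x) x)
          - (Gs (uk k x) x • Du x + Gx (uk k x) x))
          + fun x => Gs (uk k x) x • (Du x - Dk k x) := by
      filter_upwards [ae_restrict_mem hmB] with x hx
      rw [hφgrad k x hx, Pi.add_apply, smul_sub]
      abel
    beta_reduce
    rw [eLpNorm_congr_ae e]
    refine (eLpNorm_add_le ((mGs.1.add mGx.1).sub ((mGsk.smul mDu.1).add mGxk))
      (mGsk.smul (mDu.1.sub mDk)) (by norm_num)).trans (add_le_add le_rfl ?_)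
    refine eLpNorm_le_mul_eLpNorm_of_ae_le_mul ?_ 2
    filter_upwards [ae_restrict_mem hmB] with x hx
    refine (norm_smul (Gs (uk k x) x) (Du x - Dk k x)).trans_le ?_
    exact mul_le_mul_of_nonneg_right (hCs _ (huk01 k x) x hx) (norm_nonneg _)
  exact ⟨HasH1Gradient.of_tendsto mG (mGs.add mGx) hφtest t1 t2, φ, hφtest, t1, t2⟩

/-! ### Comparison with a paraboloid -/

/-- The excess of `(s + κ)^{2 - a} / (2 - a)` over the paraboloid `C |x - p|² + ε`. -/
def excess (a κ C ε : ℝ) (p : E n) (s : ℝ) (x : E n) : ℝ :=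
  (s + κ) ^ (2 - a) / (2 - a) - (C * ‖x - p‖ ^ 2 + ε)

theorem contDiff_expNegInvGlue : ContDiff ℝ ((⊤ : ℕ∞) : WithTop ℕ∞) expNegInvGlue :=
  expNegInvGlue.contDiff

theorem hasDerivAt_expNegInvGlue (s : ℝ) :
    HasDerivAt expNegInvGlue (deriv expNegInvGlue s) s :=
  (contDiff_expNegInvGlue.differentiable (by simp) s).hasDerivAt

theorem continuous_deriv_expNegInvGlue : Continuous (deriv expNegInvGlue) :=
  contDiff_expNegInvGlue.continuous_deriv (by simp)

theorem deriv_expNegInvGlue_nonneg (s : ℝ) : 0 ≤ deriv expNegInvGlue s :=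
  expNegInvGlue.monotone.deriv_nonneg

theorem expNegInvGlue_le_one (s : ℝ) : expNegInvGlue s ≤ 1 := by
  unfold expNegInvGlue
  split_ifs with h
  · exact zero_le_one
  · exact Real.exp_le_one_iff.2 (neg_nonpos.2 (inv_nonneg.2 (not_le.1 h).le))

/-- Used with `b = 0` for the cutoff `ψ` and with `b = 1 - a` for the variation. The shift `κ > 0`
keeps all powers smooth up to `s = 0`. -/
theorem isChainFunction_excess {a κ : ℝ} (C ε b : ℝ) (p : E n) (ha : a < 2) (hκ : 0 < κ) :
    IsChainFunction
      (fun s x => (s + κ) ^ b * expNegInvGlue (excess a κ C ε p s x))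
      (fun s x => b * (s + κ) ^ (b - 1) * expNegInvGlue (excess a κ C ε p s x)
        + (s + κ) ^ b * (s + κ) ^ (1 - a) * deriv expNegInvGlue (excess a κ C ε p s x))
      (fun s x => -((s + κ) ^ b * deriv expNegInvGlue (excess a κ C ε p s x) * (2 * C)) • (x - p))
      where
  contDiff w hw hw0 := by
    have hne : ∀ x, w x + κ ≠ 0 := fun x => by linarith [hw0 x]
    have h1 : ∀ c : ℝ, ContDiff ℝ ((⊤ : ℕ∞) : WithTop ℕ∞) (fun x => (w x + κ) ^ c) :=
      fun c => (hw.add contDiff_const).rpow_const_of_ne hne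
    refine (h1 b).mul (contDiff_expNegInvGlue.comp ?_)
    exact ((h1 _).div_const _).sub
      ((contDiff_const.mul ((contDiff_id.sub contDiff_const).norm_sq ℝ)).add contDiff_const)
  hasGradientAt w g x hg hw0 := by
    have hpos : 0 < w x + κ := by linarith
    have h1 : ∀ c : ℝ, HasFDerivAt (fun z => (w z + κ) ^ c)
        ((c * (w x + κ) ^ (c - 1)) • InnerProductSpace.toDual ℝ (E n) g) x := fun c =>
      (hg.hasFDerivAt.add_const κ).rpow_const (Or.inl hpos.ne')
    have h2 := (hasGradientAt_norm_sub_sq p x).hasFDerivAt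
    have h3 : HasFDerivAt (fun z => excess a κ C ε p (w z) z) _ x :=
      ((h1 (2 - a)).mul_const (2 - a)⁻¹).sub ((h2.const_mul C).add_const ε)
    have h4 := (h1 b).mul ((hasDerivAt_expNegInvGlue _).comp_hasFDerivAt x h3)
    rw [hasGradientAt_iff_hasFDerivAt]
    refine h4.congr_fderiv ?_
    ext e
    have e1 : (2 - a) - 1 = 1 - a := by ring
    have e2 : 2 - a ≠ 0 := by linarith
    simp only [e1, add_apply, smul_apply,
      sub_apply, InnerProductSpace.toDual_apply_apply, smul_eq_mul,
      inner_add_left, real_inner_smul_left, Function.comp_apply]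
    field_simp
    ring
  continuousOn := by
    have hr : ∀ c : ℝ, ContinuousOn (fun z : ℝ × E n => (z.1 + κ) ^ c) (Icc 0 1 ×ˢ univ) :=
      fun c => ContinuousOn.rpow_const (by fun_prop) fun z hz => Or.inl (by linarith [hz.1.1])
    have hex : ContinuousOn (fun z : ℝ × E n => excess a κ C ε p z.1 z.2) (Icc 0 1 ×ˢ univ) :=
      ((hr _).div_const _).sub (by fun_prop)
    exact (hr b).mul (contDiff_expNegInvGlue.continuous.comp_continuousOn hex)
  continuousOn_fst := by
    have hr : ∀ c : ℝ, ContinuousOn (fun z : ℝ × E n => (z.1 + κ) ^ c) (Icc 0 1 ×ˢ univ) :=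
      fun c => ContinuousOn.rpow_const (by fun_prop) fun z hz => Or.inl (by linarith [hz.1.1])
    have hex : ContinuousOn (fun z : ℝ × E n => excess a κ C ε p z.1 z.2) (Icc 0 1 ×ˢ univ) :=
      ((hr _).div_const _).sub (by fun_prop)
    exact ((continuousOn_const.mul (hr _)).mul
      (contDiff_expNegInvGlue.continuous.comp_continuousOn hex)).add
      (((hr b).mul (hr _)).mul (continuous_deriv_expNegInvGlue.comp_continuousOn hex))
  continuousOn_snd := by
    have hr : ∀ c : ℝ, ContinuousOn (fun z : ℝ × E n => (z.1 + κ) ^ c) (Icc 0 1 ×ˢ univ) :=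
      fun c => ContinuousOn.rpow_const (by fun_prop) fun z hz => Or.inl (by linarith [hz.1.1])
    have hex : ContinuousOn (fun z : ℝ × E n => excess a κ C ε p z.1 z.2) (Icc 0 1 ×ˢ univ) :=
      ((hr _).div_const _).sub (by fun_prop)
    exact (((hr b).mul (continuous_deriv_expNegInvGlue.comp_continuousOn hex)).mul
      continuousOn_const).neg.smul (by fun_prop)

/-- The decrease of the potential term along the variation `s ↦ s - t (s + κ)^{1-a} ψ`. -/
theorem potential_variation_le {δ₀ γ₀ a d g s κ t ψ : ℝ} (hδ₀ : 0 < δ₀) (hγ₀ : 0 < γ₀)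
    (hd : δ₀ ≤ d) (hg : γ₀ ≤ g) (hga : g ≤ a) (ha : a ≤ 1) (hs0 : 0 ≤ s) (hs1 : s ≤ 1) (hκ : 0 < κ)
    (ht0 : 0 ≤ t) (hψ0 : 0 ≤ ψ) (hψ1 : ψ ≤ 1) (htκ : t * (1 + κ) ≤ κ) (hψ : 0 < ψ → κ ≤ s) :
    d * (max (s - t * ((s + κ) ^ (1 - a) * ψ)) 0) ^ g ≤ d * (max s 0) ^ g - t * (δ₀ * γ₀ * ψ) := by
  rcases hψ0.eq_or_lt with rfl | hψpos
  · simp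
  have hsκ := hψ hψpos
  have hs : 0 < s := hκ.trans_le hsκ
  set k := (s + κ) ^ (1 - a) with hk
  have hk0 : 0 ≤ k := Real.rpow_nonneg (by positivity) _
  have hk1 : k ≤ 1 + κ := by
    calc k ≤ (1 + κ) ^ (1 - a) :=
          Real.rpow_le_rpow (by positivity) (by linarith) (by linarith)
      _ ≤ (1 + κ) ^ (1 : ℝ) :=
          Real.rpow_le_rpow_of_exponent_le (by linarith) (by linarith)
      _ = 1 + κ := Real.rpow_one _
  -- The varied value stays nonnegative, so the truncation `max · 0` is inactive.
  have hle : t * (k * ψ) ≤ s := by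
    calc t * (k * ψ) ≤ t * ((1 + κ) * 1) := by gcongr
      _ = t * (1 + κ) := by ring
      _ ≤ s := htκ.trans hsκ
  have hg0 : 0 < g := hγ₀.trans_le hg
  rw [max_eq_left (by linarith), max_eq_left hs0]
  have e1 : s - t * (k * ψ) = s * (1 + -(t * (k * ψ) / s)) := by field_simp; ring
  have hq : t * (k * ψ) / s ≤ 1 := (div_le_one hs).2 hle
  -- Bernoulli's inequality, that is, concavity of the power since `g ≤ 1`.
  have h1 : (s - t * (k * ψ)) ^ g ≤ s ^ g * (1 + g * -(t * (k * ψ) / s)) := by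
    rw [e1, Real.mul_rpow hs0 (by linarith)]
    gcongr
    exact rpow_one_add_le_one_add_mul_self (by linarith) hg0.le (hga.trans ha)
  -- The weight is chosen for this: `s^{g - 1} (s + κ)^{1 - a} ≥ s^{g - a} ≥ 1`, because `s ≤ 1` and
  -- `g ≤ a`.
  have h2 : 1 ≤ s ^ g * k / s := by
    have h3 : s ^ (1 - a) ≤ k := Real.rpow_le_rpow hs0 (by linarith) (by linarith)
    calc (1 : ℝ) ≤ s ^ (g - a) := Real.one_le_rpow_of_pos_of_le_one_of_nonpos hs hs1 (by linarith)
      _ = s ^ g * s ^ (1 - a) / s := by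
        rw [← Real.rpow_add hs, ← Real.rpow_sub_one hs.ne']
        congr 1
        ring
      _ ≤ _ := by gcongr
  have h4 : δ₀ * γ₀ ≤ d * g := mul_le_mul hd hg hγ₀.le (hδ₀.le.trans hd)
  have h5 : t * (δ₀ * γ₀ * ψ) ≤ d * g * (t * ψ) * (s ^ g * k / s) := by
    have : 0 ≤ d * g * (t * ψ) := by
      have : 0 ≤ d := hδ₀.le.trans hd
      positivity
    calc t * (δ₀ * γ₀ * ψ) = δ₀ * γ₀ * (t * ψ) := by ring
      _ ≤ d * g * (t * ψ) := by gcongr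
      _ = d * g * (t * ψ) * 1 := by ring
      _ ≤ _ := by gcongr
  calc d * (s - t * (k * ψ)) ^ g ≤ d * (s ^ g * (1 + g * -(t * (k * ψ) / s))) := by
        have : 0 ≤ d := hδ₀.le.trans hd
        gcongr
    _ = d * s ^ g - d * g * (t * ψ) * (s ^ g * k / s) := by ring
    _ ≤ _ := by linarith

/-- Integration by parts against the field `x - p`, whose divergence is `n`. -/
theorem IsTestFunction.setIntegral_inner_sub {Ω : Set (E n)} {φ : E n → ℝ}
    (h : IsTestFunction Ω φ) (p : E n) :
    ∫ x in Ω, inner ℝ (gradient φ x) (x - p) = -(n * ∫ x in Ω, φ x) := by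
  set e : Fin n → E n := fun i => EuclideanSpace.single i 1 with he
  have h1 : ∀ x, inner ℝ (gradient φ x) (x - p) = ∑ i, (x - p) i * fderiv ℝ φ x (e i) := by
    intro x
    rw [PiLp.inner_apply]
    refine Finset.sum_congr rfl fun i _ => ?_
    rw [← inner_gradient, he, EuclideanSpace.inner_single_right]
    simp
  have hc : ∀ i, ContDiff ℝ 1 (fun x : E n => (x - p) i) := fun i => by
    have : ContDiff ℝ 1 (fun x : E n => (EuclideanSpace.proj i : E n →L[ℝ] ℝ) (x - p)) :=
      (ContinuousLinearMap.contDiff _).comp (contDiff_id.sub contDiff_const)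
    exact this
  have hfd : ∀ i x, fderiv ℝ (fun x : E n => (x - p) i) x (e i) = 1 := fun i x => by
    have : HasFDerivAt (fun x : E n => (EuclideanSpace.proj i : E n →L[ℝ] ℝ) (x - p))
        ((EuclideanSpace.proj i : E n →L[ℝ] ℝ).comp (ContinuousLinearMap.id ℝ (E n))) x :=
      (ContinuousLinearMap.hasFDerivAt _).comp x ((hasFDerivAt_id x).sub_const p)
    have h2 : fderiv ℝ (fun x : E n => (x - p) i) x = _ := this.fderiv
    rw [h2]
    simp [he]
  simp_rw [h1]
  rw [integral_finsetSum]
  · simp_rw [fun i => h.setIntegral_mul_fderiv (hc i) (e i), hfd, one_mul]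
    simp
  · intro i _
    refine Integrable.integrableOn ?_
    exact ((hc i).continuous.mul
      (h.continuous_fderiv.clm_apply continuous_const)).integrable_of_hasCompactSupport
      (h.2.1.fderiv_apply (𝕜 := ℝ) (e i)).mul_left

theorem HasH10Gradient.setIntegral_inner_sub {y : E n} {r : ℝ} {v : E n → ℝ} {Dv : E n → E n}
    (h : HasH10Gradient (Metric.ball y r) v Dv) (p : E n) :
    ∫ x in Metric.ball y r, inner ℝ (Dv x) (x - p) = -(n * ∫ x in Metric.ball y r, v x) := by
  obtain ⟨φ, hφ, h1, h2⟩ := h.exists_approx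
  have hxp : MemLp (fun x => x - p) 2 (volume.restrict (Metric.ball y r)) := by
    refine MemLp.of_bound (C := r + ‖y - p‖) (by fun_prop) ?_
    filter_upwards [ae_restrict_mem measurableSet_ball] with z hz
    calc ‖z - p‖ = ‖(z - y) + (y - p)‖ := by congr 1; abel
      _ ≤ ‖z - y‖ + ‖y - p‖ := norm_add_le _ _
      _ ≤ _ := by
        rw [← dist_eq_norm z y]
        gcongr
        exact (Metric.mem_ball.1 hz).le
  have t2 := tendsto_integral_inner h.hasH1Gradient.memLp_grad (fun k => (hφ k).memLp_gradient _)
    hxp h2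
  have t1 := tendsto_integral_inner h.hasH1Gradient.memLp (fun k => (hφ k).memLp _)
    (memLp_const (1 : ℝ)) h1
  have e : ∀ s : ℝ, inner ℝ s (1 : ℝ) = s := fun s => by simp
  simp_rw [e] at t1
  refine tendsto_nhds_unique t2 ?_
  simp_rw [fun k => (hφ k).setIntegral_inner_sub p]
  exact (t1.const_mul _).neg

/-- The key comparison: below the critical opening, a paraboloid that dominates
`(u + κ)^{2 - a} / (2 - a)` near the boundary of a ball dominates it in the ball. -/
theorem IsNormalizedMinimizer.ae_excess_nonpos {δ γ u : E n → ℝ}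
    (hu : IsNormalizedMinimizer δ γ u) (h : IsAdmissible δ γ) {δ₀ γ₀ a : ℝ} (hδ₀ : 0 < δ₀)
    (hγ₀ : 0 < γ₀) (ha : a ≤ 1) {y p : E n} {r η M κ C ε : ℝ} (hr : ‖y‖ + r < 1)
    (hδ : ∀ᵐ x ∂(volume.restrict (Metric.ball y r)), δ₀ ≤ δ x)
    (hγ : ∀ᵐ x ∂(volume.restrict (Metric.ball y r)), γ₀ ≤ γ x)
    (hγa : ∀ᵐ x ∂(volume.restrict (Metric.ball y r)), γ x ≤ a)
    (hη : 0 < η) (hM0 : 0 ≤ M)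
    (hM : ∀ᵐ x, r - η < dist x y → dist x y < r + η → u x ≤ M)
    (hκ : 0 < κ) (hε : (2 * κ) ^ (2 - a) / (2 - a) ≤ ε) (hC0 : 0 ≤ C) (hC : 2 * n * C < δ₀ * γ₀)
    (hbd : ∀ x, r - η < dist x y → dist x y < r → excess a κ C ε p M x ≤ 0) :
    ∀ᵐ x ∂(volume.restrict (Metric.ball y r)), excess a κ C ε p (u x) x ≤ 0 := by
  set B := Metric.ball y r with hB
  have hBsub : B ⊆ Metric.ball (0 : E n) 1 :=
    Metric.ball_subset_closedBall.trans (closedBall_subset_unitBall hr)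
  obtain ⟨Du, hDu⟩ := hu.isLocalMinimizer.memH1
  have ha2 : 0 < 2 - a := by linarith
  have hmono : ∀ {s s' : ℝ} {x : E n}, 0 ≤ s → s ≤ s' →
      excess a κ C ε p s x ≤ excess a κ C ε p s' x := by
    intro s s' x hs hss
    unfold excess
    gcongr
  have hzero : ∀ s x, 0 ≤ s → s ≤ M → r - η < dist x y → dist x y < r →
      expNegInvGlue (excess a κ C ε p s x) = 0 := fun s x hs hsM h1 h2 =>
    expNegInvGlue.zero_of_nonpos ((hmono hs hsM).trans (hbd x h1 h2))
  have hψ := (isChainFunction_excess (a := a) C ε 0 p (by linarith) hκ).hasH10Gradient hDu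
    hu.ae_indicator_mem hr hη hM0 hM fun s x hs hsM h1 h2 => by
      simp only [hzero s x hs hsM h1 h2, mul_zero]
  have hζ := (isChainFunction_excess (a := a) C ε (1 - a) p (by linarith) hκ).hasH10Gradient hDu
    hu.ae_indicator_mem hr hη hM0 hM fun s x hs hsM h1 h2 => by
      simp only [hzero s x hs hsM h1 h2, mul_zero]
  rw [← hB] at hψ hζ
  simp only [Real.rpow_zero, one_mul, zero_mul, zero_add] at hψ
  set ψ : E n → ℝ := fun x => expNegInvGlue (excess a κ C ε p (u x) x) with hψdef
  have hψ0 : ∀ x, 0 ≤ ψ x := fun x => expNegInvGlue.nonneg _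
  have iψ : Integrable ψ (volume.restrict B) := hψ.hasH1Gradient.memLp.integrable (by norm_num)
  have huB := hu.ae_restrict_ball_mem hr
  have hvar := hu.isLocalMinimizer.first_variation (Metric.isOpen_ball (x := y) (ε := r)) hBsub
    (hDu.mono hBsub measurableSet_ball) (fun x hx => h.nonneg_delta x (hBsub hx))
    ((h.integrableOn_potential hu).mono_set hBsub) hζ (g := fun x => δ₀ * γ₀ * ψ x)
    (iψ.const_mul _) (t₀ := κ / (1 + κ)) (by positivity) (fun t ht => by
      filter_upwards [hδ, hγ, hγa, huB] with x h1 h2 h3 h4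
      refine potential_variation_le hδ₀ hγ₀ h1 h2 h3 ha h4.1 h4.2 hκ ht.1.le (hψ0 x)
        (expNegInvGlue_le_one _) ((lt_div_iff₀ (by positivity)).1 ht.2).le fun hpos => ?_
      -- If `u < κ`, then `(u + κ)^{2 - a} / (2 - a)` is at most `(2 κ)^{2 - a} / (2 - a) ≤ ε`, so
      -- the excess is nonpositive and `ψ` vanishes.
      by_contra hlt
      refine hpos.ne' (expNegInvGlue.zero_of_nonpos ((hmono h4.1 (not_le.1 hlt).le).trans ?_))
      rw [excess, ← two_mul]
      have : 0 ≤ C * ‖x - p‖ ^ 2 := by positivity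
      linarith)
  rw [← hB] at hvar
  have hxp : MemLp (fun x => x - p) 2 (volume.restrict B) := by
    refine MemLp.of_bound (C := r + ‖y - p‖) (by fun_prop) ?_
    filter_upwards [ae_restrict_mem measurableSet_ball] with z hz
    calc ‖z - p‖ = ‖(z - y) + (y - p)‖ := by congr 1; abel
      _ ≤ ‖z - y‖ + ‖y - p‖ := norm_add_le _ _
      _ ≤ _ := by
        rw [← dist_eq_norm z y]
        gcongr
        exact (Metric.mem_ball.1 hz).le
  have hdiv := hψ.setIntegral_inner_sub p
  rw [← hB] at hdiv
  -- Pointwise `⟨Du, Dζ⟩ - 2 C ⟨Dψ, x - p⟩` is the sum of two nonnegative terms: `(1 - a) (u +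
  -- κ)^{-a} ψ |Du|²` and the square `Φ' |k Du - 2 C (x - p)|²`.
  have hcomp := integral_mono_ae
    ((integrable_inner_of_memLp hψ.hasH1Gradient.memLp_grad hxp).const_mul (2 * C))
    (integrable_inner_of_memLp (hDu.mono hBsub measurableSet_ball).memLp_grad
      hζ.hasH1Gradient.memLp_grad) (by
      filter_upwards [huB] with x hx
      set Φ' := deriv expNegInvGlue (excess a κ C ε p (u x) x) with hΦ'
      set k := (u x + κ) ^ (1 - a) with hk
      have hΦ'0 : 0 ≤ Φ' := deriv_expNegInvGlue_nonneg _
      have h1 : 0 ≤ (1 - a) * (u x + κ) ^ (1 - a - 1) * ψ x * ‖Du x‖ ^ 2 := by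
        have h2 : 0 ≤ (u x + κ) ^ (1 - a - 1) := Real.rpow_nonneg (by linarith [hx.1]) _
        have h3 := hψ0 x
        have h4 : 0 ≤ 1 - a := by linarith
        positivity
      have h2 : 0 ≤ Φ' * ‖k • Du x - (2 * C) • (x - p)‖ ^ 2 := by positivity
      rw [norm_sub_sq_real, norm_smul, norm_smul, mul_pow, mul_pow, Real.norm_eq_abs,
        Real.norm_eq_abs, sq_abs, sq_abs, real_inner_smul_left, real_inner_smul_right] at h2
      simp only [inner_add_left, inner_add_right, real_inner_smul_left, real_inner_smul_right,
        real_inner_self_eq_norm_sq]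
      change _ ≤ ((1 - a) * (u x + κ) ^ (1 - a - 1) * ψ x + k * k * Φ') * ‖Du x‖ ^ 2
        + -(k * Φ' * (2 * C)) * inner ℝ (Du x) (x - p)
      nlinarith)
  rw [integral_const_mul, hdiv] at hcomp
  rw [integral_const_mul] at hvar
  have hI0 : 0 ≤ ∫ x in B, ψ x := integral_nonneg hψ0
  -- Combining the three integral relations gives `(δ₀ γ₀ - 2 n C) ∫ ψ ≤ 0` with a positive factor.
  have hI : ∫ x in B, ψ x = 0 := by
    refine le_antisymm ?_ hI0
    by_contra hpos
    rw [not_le] at hpos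
    nlinarith [mul_pos (sub_pos.2 hC) hpos]
  have := (integral_eq_zero_iff_of_nonneg_ae (Eventually.of_forall hψ0) iψ).1 hI
  filter_upwards [this] with x hx using expNegInvGlue.zero_iff_nonpos.1 hx

/-! ### Nondegeneracy -/

section
variable {δ γ u : E n → ℝ}

theorem ae_restrict_ball_neBot (y : E n) {r : ℝ} (hr : 0 < r) :
    (ae (volume.restrict (Metric.ball y r))).NeBot := by
  rw [ae_neBot, Ne, Measure.restrict_eq_zero]
  exact (Metric.measure_ball_pos volume y hr).ne'

theorem ae_lowerExp_le {f : E n → ℝ} {Ω : Set (E n)} (hΩ : MeasurableSet Ω)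
    (hf : ∀ x ∈ Ω, 0 ≤ f x) : ∀ᵐ x ∂(volume.restrict Ω), lowerExp f Ω ≤ f x :=
  ae_essInf_le ⟨0, by
    rw [eventually_map]
    filter_upwards [ae_restrict_mem hΩ] with x hx using hf x hx⟩

theorem ae_le_upperExp {f : E n → ℝ} {Ω : Set (E n)} (hΩ : MeasurableSet Ω) {K : ℝ}
    (hf : ∀ x ∈ Ω, f x ≤ K) : ∀ᵐ x ∂(volume.restrict Ω), f x ≤ upperExp f Ω :=
  ae_le_essSup ⟨K, by
    rw [eventually_map]
    filter_upwards [ae_restrict_mem hΩ] with x hx using hf x hx⟩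

theorem upperExp_le {f : E n → ℝ} {y : E n} {r : ℝ} (hr : 0 < r)
    (h0 : ∀ x ∈ Metric.ball y r, 0 ≤ f x) {K : ℝ}
    (hK : ∀ᵐ x ∂(volume.restrict (Metric.ball y r)), f x ≤ K) :
    upperExp f (Metric.ball y r) ≤ K := by
  have := ae_restrict_ball_neBot y hr
  refine limsup_le_of_le ?_ hK
  refine IsBoundedUnder.isCoboundedUnder_le ⟨0, ?_⟩
  rw [eventually_map]
  filter_upwards [ae_restrict_mem measurableSet_ball] with x hx using h0 x hx

theorem IsAdmissible.ae_gamma_le_one (h : IsAdmissible δ γ) :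
    ∀ᵐ x ∂(volume.restrict (Metric.ball (0 : E n) 1)), γ x ≤ 1 := by
  obtain ⟨K, hK⟩ := h.bounded_gamma
  filter_upwards [ae_le_upperExp measurableSet_ball hK] with x hx
  exact hx.trans h.upperExp_le_one

theorem IsNormalizedMinimizer.supSphere_nonneg (hu : IsNormalizedMinimizer δ γ u) {y : E n} {r : ℝ}
    (hr : ‖y‖ + r < 1) : 0 ≤ supSphere u y r := by
  refine Real.sSup_nonneg ?_
  rintro _ ⟨z, hz, rfl⟩
  have := closedBall_subset_unitBall hr (Metric.sphere_subset_closedBall hz)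
  exact hu.preciseRep_nonneg (by simpa using this)

/-- If `sup_{∂B_r(y)} u` is small, then `u` vanishes near the centre. -/
theorem IsNormalizedMinimizer.preciseRep_nonpos (hu : IsNormalizedMinimizer δ γ u)
    (h : IsAdmissible δ γ) {δ₀ γ₀ a : ℝ} (hδ₀ : 0 < δ₀)
    (hγ₀ : 0 < γ₀) (ha : a ≤ 1) {y p : E n} {r d C : ℝ} (hr : ‖y‖ + r < 1)
    (hδ : ∀ᵐ x ∂(volume.restrict (Metric.ball y r)), δ₀ ≤ δ x)
    (hγ : ∀ᵐ x ∂(volume.restrict (Metric.ball y r)), γ₀ ≤ γ x)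
    (hγa : ∀ᵐ x ∂(volume.restrict (Metric.ball y r)), γ x ≤ a)
    (hC0 : 0 ≤ C) (hC : 2 * n * C < δ₀ * γ₀) (hd : d < r) (hp : dist p y ≤ d)
    (hsup : supSphere u y r ^ (2 - a) < C * (r - d) ^ 2) : preciseRep u p ≤ 0 := by
  have ha2 : 0 < 2 - a := by linarith
  have hd0 : 0 ≤ d := dist_nonneg.trans hp
  have hr0 : 0 < r := hd0.trans_lt hd
  set S := supSphere u y r with hS
  have hS0 : 0 ≤ S := hu.supSphere_nonneg hr
  have hpn : ‖p‖ < 1 := by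
    calc ‖p‖ = ‖y + (p - y)‖ := by congr 1; abel
      _ ≤ ‖y‖ + dist p y := by rw [dist_eq_norm]; exact norm_add_le _ _
      _ < 1 := by linarith
  -- The strict hypothesis leaves room for a small `κ`: one `κ` raises the bound `S` to an
  -- admissible `M`, another is the shift in the excess, and a third is the width of the annulus,
  -- where `|x - p| ≥ r - κ - d`.
  have hcont : Tendsto (fun κ : ℝ => (S + 2 * κ) ^ (2 - a) - C * (r - κ - d) ^ 2) (𝓝[>] 0)
      (𝓝 ((S + 2 * 0) ^ (2 - a) - C * (r - 0 - d) ^ 2)) := by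
    have : Continuous fun κ : ℝ => (S + 2 * κ) ^ (2 - a) - C * (r - κ - d) ^ 2 :=
      (Continuous.rpow_const (by fun_prop) fun _ => Or.inr ha2.le).sub (by fun_prop)
    exact (this.tendsto 0).mono_left nhdsWithin_le_nhds
  have hlt : (S + 2 * 0) ^ (2 - a) - C * (r - 0 - d) ^ 2 < 0 := by
    rw [mul_zero, add_zero, sub_zero]
    linarith
  have hev : ∀ᶠ κ : ℝ in 𝓝[>] 0, preciseRep u p ≤ 2 * κ := by
    filter_upwards [hcont.eventually (gt_mem_nhds hlt), Ioo_mem_nhdsGT (sub_pos.2 hd)] with κ hκ1 hκ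
    have hκ0 := hκ.1
    obtain ⟨η, hη, hae⟩ := hu.exists_ae_le_of_supSphere_lt h hr0 hr
      (lt_add_of_pos_right S hκ0)
    set ε := (2 * κ) ^ (2 - a) / (2 - a) with hε
    have hε0 : 0 ≤ ε := by positivity
    have hexc := hu.ae_excess_nonpos (p := p) (η := min η κ) (M := S + κ) (κ := κ) (C := C) (ε := ε)
      h hδ₀ hγ₀ ha hr hδ hγ hγa (lt_min hη.1 hκ0) (by positivity)
      (by
        filter_upwards [hae] with x hx h1 h2
        exact hx (by linarith [min_le_left η κ]) (by linarith [min_le_left η κ]))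
      hκ0 le_rfl hC0 hC (by
        intro x h1 _
        have h3 : r - κ - d ≤ ‖x - p‖ := by
          rw [← dist_eq_norm]
          linarith [dist_triangle x p y, min_le_right η κ]
        have h4 : (r - κ - d) ^ 2 ≤ ‖x - p‖ ^ 2 :=
          pow_le_pow_left₀ (by linarith [hκ.2]) h3 2
        have h5 : (S + κ + κ) ^ (2 - a) / (2 - a) ≤ (S + κ + κ) ^ (2 - a) :=
          div_le_self (by positivity) (by linarith)
        have h6 : S + κ + κ = S + 2 * κ := by ring
        rw [excess, sub_nonpos]
        rw [h6] at h5 ⊢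
        nlinarith)
    -- Near `p` the paraboloid term is smaller than this gap, so the excess bound forces `u + κ ≤ 3
    -- κ` there.
    have hpow : (2 * κ) ^ (2 - a) < (3 * κ) ^ (2 - a) :=
      Real.rpow_lt_rpow (by positivity) (by linarith) ha2
    have hcont2 : Tendsto (fun ρ : ℝ => (2 - a) * (C * ρ ^ 2) + (2 * κ) ^ (2 - a)) (𝓝[>] 0)
        (𝓝 ((2 - a) * (C * 0 ^ 2) + (2 * κ) ^ (2 - a))) := by
      have : Continuous fun ρ : ℝ => (2 - a) * (C * ρ ^ 2) + (2 * κ) ^ (2 - a) := by fun_prop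
      exact (this.tendsto 0).mono_left nhdsWithin_le_nhds
    rw [show (2 - a) * (C * 0 ^ 2) + (2 * κ) ^ (2 - a) = (2 * κ) ^ (2 - a) by ring] at hcont2
    refine hu.preciseRep_le hpn ?_
    filter_upwards [hcont2.eventually (gt_mem_nhds hpow), eventually_small_radius hpn,
      Ioo_mem_nhdsGT (sub_pos.2 hd)] with ρ hρ1 hρ2 hρ3
    refine hu.average_le hρ2.1 hρ2.2 ?_
    have hsub : Metric.ball p ρ ⊆ Metric.ball y r :=
      Metric.ball_subset_ball' (by linarith [hρ3.2])
    filter_upwards [ae_restrict_of_ae_restrict_of_subset hsub hexc, hu.ae_restrict_ball_mem hρ2.2,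
      ae_restrict_mem measurableSet_ball] with x hx hx0 hxρ
    rw [excess, sub_nonpos, div_le_iff₀ ha2, add_mul, hε, div_mul_cancel₀ _ ha2.ne'] at hx
    have h1 : ‖x - p‖ ^ 2 ≤ ρ ^ 2 := by
      rw [← dist_eq_norm]
      exact pow_le_pow_left₀ dist_nonneg (Metric.mem_ball.1 hxρ).le 2
    have h2 : C * ‖x - p‖ ^ 2 * (2 - a) ≤ (2 - a) * (C * ρ ^ 2) := by
      rw [mul_comm]
      gcongr
    have h3 : (u x + κ) ^ (2 - a) < (3 * κ) ^ (2 - a) := by linarith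
    have h4 := (Real.rpow_lt_rpow_iff (by linarith [hx0.1]) (by positivity) ha2).1 h3
    linarith
  have hlim : Tendsto (fun κ : ℝ => 2 * κ) (𝓝[>] 0) (𝓝 (2 * 0)) :=
    (tendsto_id.const_mul 2).mono_left nhdsWithin_le_nhds
  rw [mul_zero] at hlim
  exact ge_of_tendsto hlim hev

theorem norm_add_lt_one {y : E n} {r : ℝ} (hy : y ∈ Metric.ball (0 : E n) (1 / 2)) (hr : r < 1 / 2) :
    ‖y‖ + r < 1 := by
  have : ‖y‖ < 1 / 2 := by simpa using hy
  linarith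

theorem IsAdmissible.upperExp_ball_le_one (h : IsAdmissible δ γ) {y : E n} {r : ℝ} (hr0 : 0 < r)
    (hr : ‖y‖ + r < 1) : upperExp γ (Metric.ball y r) ≤ 1 := by
  have hsub : Metric.ball y r ⊆ Metric.ball (0 : E n) 1 :=
    Metric.ball_subset_closedBall.trans (closedBall_subset_unitBall hr)
  exact upperExp_le hr0 (fun x hx => h.nonneg_gamma x (hsub hx))
    (ae_restrict_of_ae_restrict_of_subset hsub h.ae_gamma_le_one)

/-- Nondegeneracy with the explicit constant `min (δ₀ γ₀ / (4 n)) 1`. -/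
theorem IsNormalizedMinimizer.nondegeneracy (hu : IsNormalizedMinimizer δ γ u)
    (h : IsAdmissible δ γ) (hn : 1 ≤ n) {δ₀ γ₀ : ℝ} (hδ₀ : 0 < δ₀) (hγ₀ : 0 < γ₀)
    (hδ : δ₀ ≤ lowerExp δ (Metric.ball 0 1)) (hγ : γ₀ ≤ lowerExp γ (Metric.ball 0 1))
    {y : E n} (hy : y ∈ closure (posSet u) ∩ Metric.ball 0 (1 / 2)) {r : ℝ} (hr0 : 0 < r)
    (hr : r < 1 / 2) :
    min (δ₀ * γ₀ / (4 * n)) 1 * r ^ (2 / (2 - upperExp γ (Metric.ball y r))) ≤ supSphere u y r := by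
  have hyr := norm_add_lt_one hy.2 hr
  set a := upperExp γ (Metric.ball y r) with ha
  set C := δ₀ * γ₀ / (4 * n) with hCdef
  set c := min C 1 with hc
  have hn0 : (0 : ℝ) < n := by exact_mod_cast hn
  have hC0 : 0 < C := by positivity
  have hc0 : 0 < c := lt_min hC0 one_pos
  -- The choice of `C` is half the critical opening `δ₀ γ₀ / (2 n)`.
  have hC : 2 * n * C < δ₀ * γ₀ := by
    have : 2 * n * C = δ₀ * γ₀ / 2 := by
      rw [hCdef]
      field_simp
      norm_num
    rw [this]
    exact half_lt_self (by positivity)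
  have hsub : Metric.ball y r ⊆ Metric.ball (0 : E n) 1 :=
    Metric.ball_subset_closedBall.trans (closedBall_subset_unitBall hyr)
  have ha1 : a ≤ 1 := h.upperExp_ball_le_one hr0 hyr
  have ha2 : 0 < 2 - a := by linarith
  by_contra hlt
  rw [not_le] at hlt
  have hS0 := hu.supSphere_nonneg hyr
  have hS : supSphere u y r ^ (2 - a) < C * r ^ 2 := by
    calc supSphere u y r ^ (2 - a) < (c * r ^ (2 / (2 - a))) ^ (2 - a) :=
          Real.rpow_lt_rpow hS0 hlt ha2
      _ = c ^ (2 - a) * r ^ 2 := by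
          rw [Real.mul_rpow hc0.le (by positivity), ← Real.rpow_mul hr0.le,
            div_mul_cancel₀ _ ha2.ne', Real.rpow_ofNat]
      -- The reason for the minimum with `1`: for `c ≤ 1` and `2 - a ≥ 1` the power `c^{2 - a}` is
      -- at most `c`, uniformly in `a`.
      _ ≤ c ^ (1 : ℝ) * r ^ 2 := by
          gcongr ?_ * _
          exact Real.rpow_le_rpow_of_exponent_ge hc0 (min_le_right _ _) (by linarith)
      _ ≤ C * r ^ 2 := by
          rw [Real.rpow_one]
          gcongr
          exact min_le_left _ _
  -- As `y` is only in the closure of the positivity set, the paraboloid is centred at a nearby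
  -- point `p` of that set; the strict inequality absorbs the offset `d`.
  have hcont : Tendsto (fun d : ℝ => C * (r - d) ^ 2) (𝓝[>] 0) (𝓝 (C * (r - 0) ^ 2)) := by
    have : Continuous fun d : ℝ => C * (r - d) ^ 2 := by fun_prop
    exact (this.tendsto 0).mono_left nhdsWithin_le_nhds
  rw [sub_zero] at hcont
  obtain ⟨d, hd, hd0, hdr⟩ := ((hcont.eventually (lt_mem_nhds hS)).and
    (Ioo_mem_nhdsGT hr0)).exists
  obtain ⟨p, hp, hpd⟩ := Metric.mem_closure_iff.1 hy.1 d hd0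
  obtain ⟨K, hK⟩ := h.bounded_gamma
  refine hp.2.not_ge (hu.preciseRep_nonpos h hδ₀ hγ₀ ha1 hyr ?_ ?_ ?_ hC0.le hC hdr
    (by rw [dist_comm]; exact hpd.le) hd)
  · filter_upwards [ae_restrict_of_ae_restrict_of_subset hsub
      (ae_lowerExp_le measurableSet_ball h.nonneg_delta)] with x hx using hδ.trans hx
  · filter_upwards [ae_restrict_of_ae_restrict_of_subset hsub
      (ae_lowerExp_le measurableSet_ball h.nonneg_gamma)] with x hx using hγ.trans hx
  · exact ae_le_upperExp measurableSet_ball fun x hx => hK x (hsub hx)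

/-! ### Exponents under a log-Dini modulus -/

theorem HasModulusAt.le_one {ω : ℝ → ℝ} {z : E n} (hω : HasModulusAt γ ω z) (hm : IsModulus ω)
    (h : IsAdmissible δ γ) (hz : ‖z‖ < 1) : γ z ≤ 1 := by
  have hlim : Tendsto (fun ρ => 1 + ω ρ) (𝓝[>] 0) (𝓝 (1 + 0)) := hm.tendsto_zero.const_add 1
  rw [add_zero] at hlim
  refine ge_of_tendsto hlim ?_
  filter_upwards [eventually_small_radius hz] with ρ hρ
  have hsub : Metric.ball z ρ ⊆ Metric.ball (0 : E n) 1 :=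
    Metric.ball_subset_closedBall.trans (closedBall_subset_unitBall hρ.2)
  have := ae_restrict_ball_neBot z hρ.1
  obtain ⟨x, hx1, hx2⟩ := ((ae_restrict_of_ae_restrict_of_subset hsub h.ae_gamma_le_one).and
    (ae_restrict_mem measurableSet_ball)).exists
  have h1 := (abs_le.1 (hω x (hsub hx2))).1
  have h2 : ω (dist x z) ≤ ω ρ :=
    hm.mono dist_nonneg hρ.1.le (Metric.mem_ball.1 hx2).le
  linarith

theorem HasModulusAt.upperExp_le {ω : ℝ → ℝ} {z : E n} (hω : HasModulusAt γ ω z)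
    (hm : IsModulus ω) (h : IsAdmissible δ γ) {r : ℝ} (hr0 : 0 < r) (hr : ‖z‖ + r < 1) :
    upperExp γ (Metric.ball z r) ≤ γ z + ω r := by
  have hsub : Metric.ball z r ⊆ Metric.ball (0 : E n) 1 :=
    Metric.ball_subset_closedBall.trans (closedBall_subset_unitBall hr)
  refine VarSing.upperExp_le hr0 (fun x hx => h.nonneg_gamma x (hsub hx)) ?_
  filter_upwards [ae_restrict_mem measurableSet_ball] with x hx
  have h1 := (abs_le.1 (hω x (hsub hx))).2
  have h2 : ω (dist x z) ≤ ω r := hm.mono dist_nonneg hr0.le (Metric.mem_ball.1 hx).le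
  linarith

end

/-- Since `ω 1 ≥ 0`, the upper limit alone is at most `C`; passing to `C + 1` gives the strict
inequality that an upper limit turns into an eventual bound. -/
theorem LogDini.eventually_lt {ω : ℝ → ℝ} {C : ℝ} (h : LogDini ω C) (hm : IsModulus ω) :
    ∀ᶠ t in 𝓝[>] 0, ω t * Real.log (1 / t) < C + 1 := by
  have h1 : limsup (fun t : ℝ => ((ω t * Real.log (1 / t) : ℝ) : EReal)) (𝓝[>] 0) ≤ (C : EReal) := by
    refine le_trans ?_ h
    have h0 : (0 : EReal) ≤ (ω 1 : EReal) := by exact_mod_cast hm.nonneg 1 zero_le_one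
    calc _ = 0 + limsup (fun t : ℝ => ((ω t * Real.log (1 / t) : ℝ) : EReal)) (𝓝[>] 0) :=
          (zero_add _).symm
      _ ≤ _ := add_le_add h0 le_rfl
  have h2 : (C : EReal) < ((C + 1 : ℝ) : EReal) := by exact_mod_cast lt_add_one C
  filter_upwards [eventually_lt_of_limsup_lt (h1.trans_lt h2)] with t ht
  exact_mod_cast ht

/-- Comparison of the powers of the radius for nearby exponents. -/
theorem exp_mul_rpow_le {a g w r C : ℝ} (ha : a ≤ 1) (hg : g ≤ 1) (hw : 0 ≤ w) (hag : a ≤ g + w)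
    (hr0 : 0 < r) (hr1 : r ≤ 1) (hC : w * Real.log (1 / r) ≤ C) :
    Real.exp (-(2 * C)) * r ^ (2 / (2 - g)) ≤ r ^ (2 / (2 - a)) := by
  have hA : 1 ≤ 2 - a := by linarith
  have hG : 1 ≤ 2 - g := by linarith
  -- The difference of the exponents is `2 (a - g) / ((2 - a) (2 - g))`, and both factors of the
  -- denominator are at least `1`.
  have hexp : 2 / (2 - a) ≤ 2 * w + 2 / (2 - g) := by
    have hAG : 1 ≤ (2 - a) * (2 - g) := one_le_mul_of_one_le_of_one_le hA hG
    have e : 2 * w + 2 / (2 - g) - 2 / (2 - a)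
        = 2 * (w * ((2 - a) * (2 - g)) - (a - g)) / ((2 - a) * (2 - g)) := by
      have : 2 - a ≠ 0 := by linarith
      have : 2 - g ≠ 0 := by linarith
      field_simp
      ring
    have h1 : w ≤ w * ((2 - a) * (2 - g)) := le_mul_of_one_le_right hw hAG
    have : 0 ≤ 2 * w + 2 / (2 - g) - 2 / (2 - a) := by
      rw [e]
      exact div_nonneg (by linarith) (by linarith)
    linarith
  have h2 : Real.exp (-(2 * C)) ≤ r ^ (2 * w) := by
    rw [Real.rpow_def_of_pos hr0, Real.exp_le_exp]
    rw [one_div, Real.log_inv] at hC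
    linarith
  calc Real.exp (-(2 * C)) * r ^ (2 / (2 - g)) ≤ r ^ (2 * w) * r ^ (2 / (2 - g)) := by gcongr
    _ = r ^ (2 * w + 2 / (2 - g)) := (Real.rpow_add hr0 _ _).symm
    _ ≤ r ^ (2 / (2 - a)) := Real.rpow_le_rpow_of_exponent_ge hr0 hr1 hexp

end

end VarSing

open VarSing in
theorem theorem2p3 (n : ℕ) (hn : 1 ≤ n) (δ₀ γ₀ : ℝ) (hδ₀ : 0 < δ₀) (hγ₀ : 0 < γ₀) :
    (∃ c : ℝ, 0 < c ∧
      ∀ δ γ u : E n → ℝ, IsAdmissible δ γ →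
        δ₀ ≤ lowerExp δ (Metric.ball 0 1) → γ₀ ≤ lowerExp γ (Metric.ball 0 1) →
        IsNormalizedMinimizer δ γ u →
        ∀ y ∈ closure (posSet u) ∩ Metric.ball 0 (1 / 2), ∀ r : ℝ, 0 < r → r < 1 / 2 →
          c * r ^ (2 / (2 - upperExp γ (Metric.ball y r))) ≤ supSphere u y r) ∧
    (∀ C : ℝ, 0 < C → ∃ c : ℝ, 0 < c ∧
      ∀ ω : ℝ → ℝ, IsModulus ω → LogDini ω C → ∃ r₀ : ℝ, 0 < r₀ ∧ r₀ ≤ 1 / 2 ∧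
        ∀ δ γ u : E n → ℝ, IsAdmissible δ γ →
          δ₀ ≤ lowerExp δ (Metric.ball 0 1) → γ₀ ≤ lowerExp γ (Metric.ball 0 1) →
          IsNormalizedMinimizer δ γ u →
          ∀ z₀ ∈ freeBoundary u ∩ Metric.ball 0 (1 / 2), HasModulusAt γ ω z₀ →
            ∀ r : ℝ, 0 < r → r < r₀ →
              c * r ^ (2 / (2 - γ z₀)) ≤ supSphere u z₀ r) := by
  have hn0 : (0 : ℝ) < n := by exact_mod_cast hn
  have hc : 0 < min (δ₀ * γ₀ / (4 * n)) 1 := lt_min (by positivity) one_pos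
  refine ⟨⟨min (δ₀ * γ₀ / (4 * n)) 1, hc, fun δ γ u h hδ hγ hu y hy r hr0 hr =>
    hu.nondegeneracy h hn hδ₀ hγ₀ hδ hγ hy hr0 hr⟩, fun C hC => ?_⟩
  -- The first constant times the lower bound for `r^{2 ω(r)}`. The modulus enters only through the
  -- radius below which `ω(r) ln(1/r) < C + 1`.
  refine ⟨min (δ₀ * γ₀ / (4 * n)) 1 * Real.exp (-(2 * (C + 1))),
    mul_pos hc (Real.exp_pos _), fun ω hω hlog => ?_⟩
  obtain ⟨r₁, hr₁, hr₁ω⟩ := mem_nhdsGT_iff_exists_Ioo_subset.1 (hlog.eventually_lt hω)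
  refine ⟨min r₁ (1 / 2), lt_min hr₁ (by norm_num), min_le_right _ _, ?_⟩
  intro δ γ u h hδ hγ hu z₀ hz₀ hmod r hr0 hr
  have hr2 : r < 1 / 2 := hr.trans_le (min_le_right _ _)
  have hzr := norm_add_lt_one hz₀.2 hr2
  have h1 := hu.nondegeneracy h hn hδ₀ hγ₀ hδ hγ ⟨frontier_subset_closure hz₀.1, hz₀.2⟩ hr0 hr2
  have h2 : ω r * Real.log (1 / r) < C + 1 := hr₁ω ⟨hr0, hr.trans_le (min_le_left _ _)⟩
  have h3 := exp_mul_rpow_le (h.upperExp_ball_le_one hr0 hzr) (hmod.le_one hω h (by linarith))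
    (hω.nonneg r hr0.le) (hmod.upperExp_le hω h hr0 hzr) hr0 (by linarith) h2.le
  calc _ = min (δ₀ * γ₀ / (4 * n)) 1 * (Real.exp (-(2 * (C + 1))) * r ^ (2 / (2 - γ z₀))) := by ring
    _ ≤ _ := (mul_le_mul_of_nonneg_left h3 hc.le).trans h1
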